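/- **Setting (dimension 1).** For $T>0$ consider the dislocation equation $$\partial_t u=\Big(\int_{\mathbb R}c_0(x-y,t)\,\mathbf 1_{\{u(\cdot,t)\ge 0\}}(y)\,dy+c_1(x,t)\Big)|\partial_x u|\ \text{ in }\mathbb R\times(0,T),\qquad u(\cdot,0)=u_0. \tag{1}$$ A Lipschitz function $u:\mathbb R\times[0,T]\to\mathbb R$ is a *weak solution* of (1) on $[0,T)$ if there is a measurable $\chi:\mathbb R\times(0,T)\to[0,1]$ with $\mathbf 1_{\{u(\cdot,t)>0\}}(x)\le\chi(x,t)\le\mathbf 1_{\{u(\cdot,t)\ge0\}}(x)$ for a.e. $(x,t)$ such that $u$ is an $L^1$-viscosity solution (in the sense of Ishii) of $\partial_t u=\bar c(x,t)|\partial_x u|$ in $\mathbb R\times(0,T)$, $u(\cdot,0)=u_0$, where $\bar c(x,t)=\int c_0(x-y,t)\chi(y,t)\,dy+c_1(x,t)$. We then say that $u$ is a weak solution *with* $\chi$. (It is part of the definition that the convolution is well defined for a.e. $t$ and all $x$, and that $\bar c$ is measurable in $t$ and, for a.e. $t$, bounded and Lipschitz in $x$, uniformly in $t$.) The assumptions of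 the general theory are: (H0) $u_0:\mathbb R\to[-1,1]$ is Lipschitz and $u_0=-1$ outside a bounded set; (H1) $c_0\in C([0,T);L^1(\mathbb R))$, $D_xc_0\in L^\infty([0,T];L^1(\mathbb R))$, and $c_1\in C(\mathbb R\times[0,T])$ is bounded and Lipschitz in $x$ uniformly in $t$. **Data.** Let $T=2$, $c_1(x,t)=c_1(t)=2(t-1)(2-t)$, $u_0(x)=1-|x|$ and $x_1(t)=(t-1)^2$. For a measurable $\gamma:[1,2]\to[0,1]$ let $y_\gamma$ be the (Carathéodory) solution on $[1,2]$ of $$\dot y_\gamma=c_1+2\gamma\,y_\gamma,\qquad y_\gamma(1)=0. \tag{2}$$ For a datum $w$ let $$U^w_\gamma(x,t)=\inf_{|x-z|\le 1-x_1(t)}w(z)\ \ (0\le t\le1),\qquad U^w_\gamma(x,t)=\sup_{|x-z|\le y_\gamma(t)}U^w_\gamma(z,1)\ \ (1\le t\le 2),$$ and let $U_\gamma=U_\gamma^{u_0}$. Let $\chi_\gamma(\cdot,t)=\mathbf 1_{[-x_1(t),x_1(t)]}$ for $t<1$ and $\chi_\gamma(\cdot,t)=\gamma(t)\mathbf 1_{[-y_\gamma(t),y_\gamma(t)]}$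 for $1\le t\le2$. **Theorem.** 1. $\dot x_1=c_1+2x_1$ on $[0,1]$ and $x_1(0)=1$. For every measurable $\gamma:[1,2]\to[0,1]$ problem (2) has exactly one solution $y_\gamma$. Moreover $0\le y_0\le y_\gamma\le y_1$ on $[1,2]$ (where $y_0,y_1$ correspond to $\gamma\equiv0$ and $\gamma\equiv 1$), $y_\gamma$ is nondecreasing, and $y_\gamma>0$ on $(1,2]$. 2. For $0\le t\le 1$: $U_\gamma(x,t)=u_0(|x|-x_1(t)+1)$, $\{U_\gamma(\cdot,t)>0\}=(-x_1(t),x_1(t))$ and $\{U_\gamma(\cdot,t)\ge0\}=[-x_1(t),x_1(t)]$. For $1\le t\le2$: $U_\gamma(x,t)=0$ if $|x|\le y_\gamma(t)$ and $U_\gamma(x,t)=U_\gamma(|x|-y_\gamma(t),1)$ otherwise; $\{U_\gamma(\cdot,t)>0\}=\emptyset$ and $\{U_\gamma(\cdot,t)\ge0\}=\{U_\gamma(\cdot,t)=0\}=[-y_\gamma(t),y_\gamma(t)]$, so that the zero set fattens for $t>1$. 3. Let $c_0\equiv1$. For every measurable $\gamma:[1,2]\to[0,1]$ the function $U_\gamma$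 is a weak solution of (1) on $[0,2)$ with $\chi_\gamma$. The corresponding velocity $\bar c$ is $c_1(t)+2x_1(t)$ for $0\le t<1$ and $c_1(t)+2\gamma(t)y_\gamma(t)$ for $1\le t\le2$. Moreover $U_\gamma=U_{\gamma'}$ on $\mathbb R\times[0,2]$ if and only if $\gamma=\gamma'$ a.e. on $[1,2]$. In particular weak solutions of (1) are not unique. 4. The kernel can be modified at infinity so that the general assumptions hold. Let $\tilde u_0=\max(u_0,-1)$, which satisfies (H0). For every $R$ there is a kernel $c_0\ge0$ with $c_0(x,t)=1$ for $|x|\le R$ such that (H1) holds and, for every measurable $\gamma:[1,2]\to[0,1]$, the function $U^{\tilde u_0}_\gamma=\max(U_\gamma,-1)$ is a weak solution on $[0,2)$, with $\chi_\gamma$, of (1) with initial datum $\tilde u_0$. In particular, weak solutions are not unique for this nonnegative kernel and datum, even though (H0) and (H1) hold. -/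

import Mathlib

open Set MeasureTheory Filter Topology
open scoped ContDiff

noncomputable section

namespace Dislocation

/-! ## `L¹`-viscosity solutions of `∂v/∂t = c(x,t) |∂v/∂x|` in `ℝ × (0,T)`, `v(·,0) = u₀`

A function of `(x,t)` is a curried function `ℝ → ℝ → ℝ`, space variable first.  Only its values on
`ℝ × [0,T]` (or `ℝ × (0,T)`) are used. -/

/-- `v` is an `L¹`-viscosity subsolution on `ℝ × [0,T]` for the velocity `c` and the datum `u₀`. -/
def IsL1Subsolution (T : ℝ) (c : ℝ → ℝ → ℝ) (u₀ : ℝ → ℝ) (v : ℝ → ℝ → ℝ) : Prop :=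
  UpperSemicontinuousOn (Function.uncurry v) (univ ×ˢ Icc 0 T) ∧
  (∀ x, v x 0 ≤ u₀ x) ∧
  ∀ (x₀ t₀ : ℝ) (b : ℝ → ℝ) (φ : ℝ × ℝ → ℝ) (G : ℝ × ℝ × ℝ → ℝ),
    t₀ ∈ Ioo 0 T →
    IntegrableOn b (Ioo 0 T) →
    ContDiffOn ℝ ∞ φ (univ ×ˢ Ioo 0 T) →
    ContinuousOn G (univ ×ˢ Ioo 0 T ×ˢ univ) →
    IsLocalMaxOn (fun z : ℝ × ℝ => v z.1 z.2 - (∫ s in (0 : ℝ)..z.2, b s) - φ z)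
      (univ ×ˢ Ioo 0 T) (x₀, t₀) →
    (∃ ε > 0, ∀ᵐ t ∂(volume.restrict (Ioo 0 T)), |t - t₀| < ε →
      ∀ x p, |x - x₀| < ε → |p - deriv (fun x => φ (x, t₀)) x₀| < ε →
        c x t * |p| - b t ≤ G (x, t, p)) →
    deriv (fun t => φ (x₀, t)) t₀ ≤ G (x₀, t₀, deriv (fun x => φ (x, t₀)) x₀)

/-- `v` is an `L¹`-viscosity supersolution on `ℝ × [0,T]` for the velocity `c` and the datum
`u₀`. -/
def IsL1Supersolution (T : ℝ) (c : ℝ → ℝ → ℝ) (u₀ : ℝ → ℝ) (v : ℝ → ℝ → ℝ) : Prop :=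
  LowerSemicontinuousOn (Function.uncurry v) (univ ×ˢ Icc 0 T) ∧
  (∀ x, u₀ x ≤ v x 0) ∧
  ∀ (x₀ t₀ : ℝ) (b : ℝ → ℝ) (φ : ℝ × ℝ → ℝ) (G : ℝ × ℝ × ℝ → ℝ),
    t₀ ∈ Ioo 0 T →
    IntegrableOn b (Ioo 0 T) →
    ContDiffOn ℝ ∞ φ (univ ×ˢ Ioo 0 T) →
    ContinuousOn G (univ ×ˢ Ioo 0 T ×ˢ univ) →
    IsLocalMinOn (fun z : ℝ × ℝ => v z.1 z.2 - (∫ s in (0 : ℝ)..z.2, b s) - φ z)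
      (univ ×ˢ Ioo 0 T) (x₀, t₀) →
    (∃ ε > 0, ∀ᵐ t ∂(volume.restrict (Ioo 0 T)), |t - t₀| < ε →
      ∀ x p, |x - x₀| < ε → |p - deriv (fun x => φ (x, t₀)) x₀| < ε →
        G (x, t, p) ≤ c x t * |p| - b t) →
    G (x₀, t₀, deriv (fun x => φ (x, t₀)) x₀) ≤ deriv (fun t => φ (x₀, t)) t₀

/-- `L¹`-viscosity solution.  It is used for continuous `v` only, which is its own upper and lower
semicontinuous envelope. -/
def IsL1ViscositySolution (T : ℝ) (c : ℝ → ℝ → ℝ) (u₀ : ℝ → ℝ) (v : ℝ → ℝ → ℝ) : Prop :=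
  IsL1Subsolution T c u₀ v ∧ IsL1Supersolution T c u₀ v

/-- The standing assumption on a velocity `c` under which `L¹`-viscosity solutions are considered:
measurable in `t`, and, for a.e. `t`, bounded and Lipschitz in `x`, uniformly in `t`. -/
def IsAdmissibleVelocity (T : ℝ) (c : ℝ → ℝ → ℝ) : Prop :=
  (∀ x, AEMeasurable (c x) (volume.restrict (Ioo 0 T))) ∧
  ∃ M L : ℝ, ∀ᵐ t ∂(volume.restrict (Ioo 0 T)), ∀ x y,
    |c x t| ≤ M ∧ |c x t - c y t| ≤ L * |x - y|

/-! ## Weak solutions of `∂u/∂t = (c₀(·,t) ⋆ 1_{u(·,t) ≥ 0}(x) + c₁(x,t)) |∂u/∂x|` -/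

/-- The velocity `c₀(·,t) ⋆ χ(·,t)(x) + c₁(x,t)`. -/
def velocity (c₀ c₁ χ : ℝ → ℝ → ℝ) (x t : ℝ) : ℝ :=
  (∫ y, c₀ (x - y) t * χ y t) + c₁ x t

/-- The Lipschitz function `u` is a weak solution on `[0,T)` with datum `u₀`, and the measurable
map `χ : ℝ × (0,T) → [0,1]` realises it.  The integrability clause (automatic if every `c₀(·,t)` is
integrable) says that the convolution makes sense. -/
structure IsWeakSolutionWith (T : ℝ) (c₀ c₁ : ℝ → ℝ → ℝ) (u₀ : ℝ → ℝ) (u χ : ℝ → ℝ → ℝ) :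
    Prop where
  lipschitz : ∃ K, LipschitzOnWith K (Function.uncurry u) (univ ×ˢ Icc 0 T)
  chi_measurable :
    AEMeasurable (Function.uncurry χ) (volume.restrict ((univ : Set ℝ) ×ˢ Ioo 0 T))
  chi_mem : ∀ x, ∀ t ∈ Ioo 0 T, χ x t ∈ Icc (0 : ℝ) 1
  chi_bounds : ∀ᵐ z ∂(volume.restrict ((univ : Set ℝ) ×ˢ Icc 0 T)),
    {x | 0 < u x z.2}.indicator (fun _ => (1 : ℝ)) z.1 ≤ χ z.1 z.2 ∧
    χ z.1 z.2 ≤ {x | 0 ≤ u x z.2}.indicator (fun _ => (1 : ℝ)) z.1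
  convolution_integrable : ∀ᵐ t ∂(volume.restrict (Ioo 0 T)), ∀ x,
    Integrable (fun y => c₀ (x - y) t * χ y t)
  admissible : IsAdmissibleVelocity T (velocity c₀ c₁ χ)
  solution : IsL1ViscositySolution T (velocity c₀ c₁ χ) u₀ u

/-- Weak solution of the dislocation equation on the time interval `[0,T)`. -/
def IsWeakSolution (T : ℝ) (c₀ c₁ : ℝ → ℝ → ℝ) (u₀ : ℝ → ℝ) (u : ℝ → ℝ → ℝ) : Prop :=
  ∃ χ, IsWeakSolutionWith T c₀ c₁ u₀ u χ

/-- There are two weak solutions which differ somewhere on `ℝ × [0,T]`. -/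
def WeakSolutionsNotUnique (T : ℝ) (c₀ c₁ : ℝ → ℝ → ℝ) (u₀ : ℝ → ℝ) : Prop :=
  ∃ u v, IsWeakSolution T c₀ c₁ u₀ u ∧ IsWeakSolution T c₀ c₁ u₀ v ∧
    ∃ x, ∃ t ∈ Icc 0 T, u x t ≠ v x t

/-! ## Assumptions of the general theory, in dimension 1 -/

/-- `u₀ : ℝ → [-1,1]` is Lipschitz and equal to `-1` outside a bounded set. -/
def IsAdmissibleDatum (u₀ : ℝ → ℝ) : Prop :=
  (∀ x, u₀ x ∈ Icc (-1 : ℝ) 1) ∧ (∃ K, LipschitzWith K u₀) ∧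
  ∃ R₀ > 0, ∀ x, R₀ ≤ |x| → u₀ x = -1

/-- `d` is the weak (distributional) derivative of `f` on `ℝ`, both being integrable. -/
def HasWeakDeriv (f d : ℝ → ℝ) : Prop :=
  Integrable f ∧ Integrable d ∧
  ∀ ψ : ℝ → ℝ, ContDiff ℝ ∞ ψ → HasCompactSupport ψ →
    ∫ x, f x * deriv ψ x = -∫ x, d x * ψ x

/-- `c₀ ∈ C([0,T); L¹(ℝ))`, `D_x c₀ ∈ L^∞([0,T]; L¹(ℝ))`, `c₁ ∈ C(ℝ × [0,T])`, and `c₁` is bounded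
and Lipschitz in `x`, uniformly in `t`. -/
structure AreAdmissibleCoefficients (T : ℝ) (c₀ c₁ : ℝ → ℝ → ℝ) : Prop where
  integrable : ∀ t ∈ Ico 0 T, Integrable (fun x => c₀ x t)
  continuous : ∀ t ∈ Ico 0 T,
    Tendsto (fun s => ∫ x, |c₀ x s - c₀ x t|) (𝓝[Ico 0 T] t) (𝓝 0)
  derivative : ∃ (d : ℝ → ℝ → ℝ) (L₀ : ℝ),
    AEMeasurable (Function.uncurry d) (volume.restrict ((univ : Set ℝ) ×ˢ Ioo 0 T)) ∧
    ∀ᵐ t ∂(volume.restrict (Ioo 0 T)),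
      HasWeakDeriv (fun x => c₀ x t) (fun x => d x t) ∧ ∫ x, |d x t| ≤ L₀
  drift_continuous : ContinuousOn (Function.uncurry c₁) (univ ×ˢ Icc 0 T)
  drift_bounds : ∃ M₁ L₁ : ℝ, ∀ x y, ∀ t ∈ Icc 0 T,
    |c₁ x t| ≤ M₁ ∧ |c₁ x t - c₁ y t| ≤ L₁ * |x - y|

/-! ## The data and the functions of the example -/

/-- `c₁(t) = 2 (t - 1) (2 - t)`. -/
def drift (t : ℝ) : ℝ := 2 * (t - 1) * (2 - t)

/-- `u₀(x) = 1 - |x|`. -/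
def datum (x : ℝ) : ℝ := 1 - |x|

/-- `u₀` truncated at the level `-1`. -/
def truncatedDatum (x : ℝ) : ℝ := max (datum x) (-1)

/-- `x₁(t) = (t - 1)²`. -/
def x₁ (t : ℝ) : ℝ := (t - 1) ^ 2

/-- `γ : [1,2] → [0,1]` is (Lebesgue) measurable. -/
def IsControl (γ : ℝ → ℝ) : Prop :=
  AEMeasurable γ (volume.restrict (Icc 1 2)) ∧ ∀ t ∈ Icc (1 : ℝ) 2, γ t ∈ Icc (0 : ℝ) 1

/-- `y` solves `y' = c₁ + 2 γ y` on `[1,2]`, `y(1) = 0`, in the sense of Carathéodory. -/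
def SolvesODE (γ y : ℝ → ℝ) : Prop :=
  ContinuousOn y (Icc 1 2) ∧
  ∀ t ∈ Icc (1 : ℝ) 2, y t = ∫ s in (1 : ℝ)..t, (drift s + 2 * γ s * y s)

/-- The infimum of `f` over `[x - r, x + r]`. -/
def infBall (f : ℝ → ℝ) (r x : ℝ) : ℝ := sInf (f '' Metric.closedBall x r)

/-- The supremum of `f` over `[x - r, x + r]`. -/
def supBall (f : ℝ → ℝ) (r x : ℝ) : ℝ := sSup (f '' Metric.closedBall x r)

/-- The Hopf-Lax construction from a datum `w` and a radius function `y`: for `t ≤ 1` the infimum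
of `w` over `|z - x| ≤ 1 - x₁(t)`; for `t > 1` the supremum over `|z - x| ≤ y(t)` of the function
obtained at time `1`. -/
def hopfLax (w y : ℝ → ℝ) (x t : ℝ) : ℝ :=
  if t ≤ 1 then infBall w (1 - x₁ t) x else supBall (infBall w (1 - x₁ 1)) (y t) x

/-- `χ_γ(·,t)` is the indicator of `[-x₁(t), x₁(t)]` for `t < 1`, and `γ(t)` times the indicator of
`[-y(t), y(t)]` for `t ≥ 1`. -/
def chi (γ y : ℝ → ℝ) (x t : ℝ) : ℝ :=
  if t < 1 then (Icc (-x₁ t) (x₁ t)).indicator (fun _ => 1) x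
  else (Icc (-y t) (y t)).indicator (fun _ => γ t) x

end Dislocation

end

open Dislocation

namespace Dislocation

/-! ## The ordinary differential equation -/

/-! Non-uniqueness comes from fattening. The positive interval `(-x₁, x₁)` shrinks to a point at
time `1`, where the solution equals `-|x|`. The drift is nonnegative on `[1,2]`, so the zero set
then spreads to `[-y, y]` while the solution stays nonpositive. On this set the weak formulation
asks only `0 ≤ χ ≤ 1`, so `χ = γ(t)` is allowed for every control. For `c₀ = 1` the velocity depends
on the mass of `χ` alone, namely `2 γ y`. Self-consistency is therefore the linear equation `y' =
drift + 2 γ y`, solvable for every `γ`. Since `y > 0` after time `1`, the equation can be solved for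
`γ`, so different controls give different solutions.

For radially nonincreasing data the Hopf-Lax formulas reduce to a shift of the radial variable
(`hopfLax_of_antitone`). The solution is `profile = min plateau (front - |x|)`, where `front` is
absolutely continuous with derivative `speed` almost everywhere.

The velocity is only measurable in time, so the viscosity inequalities are obtained by following the
solution backwards along a well-chosen Lipschitz curve (`deriv_time_le_of_isLocalMax`,
`subsolutionAt_of_curve`). Where the solution has slope `±1` in space, the curve is vertical and the
evolution is exactly that of the front. On flat regions the slope vanishes and the velocity is
irrelevant. At the concave kink the supersolution test is void, and the subsolution test follows
from the sign of `speed` before time `1` and by moving with the front afterwards. Truncation at `-1`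
adds a convex kink, where the roles are exchanged and the curve is the level line.

After truncation nothing happens outside `|x| ≤ 2`, and `χ` lives in `[-1,1]`, so only the values of
the kernel on `[-3,3]` matter. Any smooth compactly supported kernel equal to `1` there gives the
same solutions. -/

theorem continuous_drift : Continuous drift := by unfold drift; fun_prop

theorem drift_nonneg {t : ℝ} (ht : t ∈ Icc (1 : ℝ) 2) : 0 ≤ drift t := by
  unfold drift; exact mul_nonneg (by linarith [ht.1]) (by linarith [ht.2])

theorem exists_continuous_extension {w : ℝ → ℝ} (hw : ContinuousOn w (Icc 1 2)) :
    ∃ v : ℝ → ℝ, Continuous v ∧ EqOn v w (Icc 1 2) :=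
  ⟨IccExtend one_le_two ((Icc (1 : ℝ) 2).domRestrict w),
    (continuousOn_iff_continuous_domRestrict.1 hw).Icc_extend',
    fun t ht => by rw [IccExtend_of_mem _ _ ht]; rfl⟩

/-- Grönwall's inequality in integral form. -/
theorem nonpos_of_le_integral_posPart {w : ℝ → ℝ} (hw : ContinuousOn w (Icc 1 2))
    (h : ∀ t ∈ Icc (1 : ℝ) 2, w t ≤ ∫ s in (1 : ℝ)..t, 2 * max (w s) 0) :
    ∀ t ∈ Icc (1 : ℝ) 2, w t ≤ 0 := by
  obtain ⟨v, hv, hvw⟩ := exists_continuous_extension hw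
  have hm : Continuous fun s => 2 * max (v s) 0 := by fun_prop
  have hint : ∀ t ∈ Icc (1 : ℝ) 2,
      ∫ s in (1 : ℝ)..t, 2 * max (w s) 0 = ∫ s in (1 : ℝ)..t, 2 * max (v s) 0 := by
    intro t ht
    refine intervalIntegral.integral_congr fun s hs => ?_
    rw [uIcc_of_le ht.1] at hs
    simp only [hvw ⟨hs.1, hs.2.trans ht.2⟩]
  have hpos : ∀ t ∈ Icc (1 : ℝ) 2, 0 ≤ ∫ s in (1 : ℝ)..t, 2 * max (v s) 0 := fun t ht =>
    intervalIntegral.integral_nonneg ht.1 fun s _ => by positivity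
  have hd : ∀ t, HasDerivAt (fun t => ∫ s in (1 : ℝ)..t, 2 * max (v s) 0) (2 * max (v t) 0) t :=
    fun t => intervalIntegral.integral_hasDerivAt_right (hm.intervalIntegrable _ _)
      (hm.stronglyMeasurableAtFilter _ _) hm.continuousAt
  -- The integral `F` of `2 max v 0` starts at zero and dominates `max v 0`, so `F' ≤ 2 F` forces `F
  -- = 0`.
  have hzero := eq_zero_of_abs_deriv_le_mul_abs_self_of_eq_zero_right
    (f := fun t => ∫ s in (1 : ℝ)..t, 2 * max (v s) 0) (K := 2) (a := 1) (b := 2)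
    (fun t _ => (hd t).continuousAt.continuousWithinAt) (fun t _ => (hd t).hasDerivWithinAt)
    (by simp) (fun t ht => by
      have ht' := Ico_subset_Icc_self ht
      rw [Real.norm_of_nonneg (by positivity), Real.norm_of_nonneg (hpos t ht')]
      have h1 := h t ht'
      rw [hint t ht', ← hvw ht'] at h1
      gcongr
      exact max_le h1 (hpos t ht'))
  intro t ht
  have := h t ht
  rwa [hint t ht, hzero t ht] at this

theorem IsControl.integrableOn {γ : ℝ → ℝ} (hγ : IsControl γ) : IntegrableOn γ (Icc 1 2) := by
  refine Integrable.of_bound hγ.1.aestronglyMeasurable 1 ?_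
  filter_upwards [ae_restrict_mem measurableSet_Icc] with t ht
  rw [Real.norm_of_nonneg (hγ.2 t ht).1]
  exact (hγ.2 t ht).2

theorem isControl_const {c : ℝ} (hc : c ∈ Icc (0 : ℝ) 1) : IsControl fun _ => c :=
  ⟨aemeasurable_const, fun _ _ => hc⟩

theorem IsControl.integrableOn_mul {γ y : ℝ → ℝ} (hγ : IsControl γ)
    (hy : ContinuousOn y (Icc 1 2)) : IntegrableOn (fun t => 2 * γ t * y t) (Icc 1 2) :=
  IntegrableOn.mul_continuousOn (Integrable.const_mul hγ.integrableOn 2) hy isCompact_Icc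

theorem intervalIntegrable_of_integrableOn_Icc {f : ℝ → ℝ} {a b s t : ℝ}
    (hf : IntegrableOn f (Icc a b)) (hs : s ∈ Icc a b) (ht : t ∈ Icc a b) :
    IntervalIntegrable f volume s t := by
  rw [intervalIntegrable_iff]
  exact hf.mono_set (uIoc_subset_uIcc.trans (uIcc_subset_Icc hs ht))

theorem one_mem : (1 : ℝ) ∈ Icc (1 : ℝ) 2 := ⟨le_rfl, one_le_two⟩

theorem IsControl.integrableOn_rhs {γ y : ℝ → ℝ} (hγ : IsControl γ)
    (hy : ContinuousOn y (Icc 1 2)) :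
    IntegrableOn (fun t => drift t + 2 * γ t * y t) (Icc 1 2) :=
  (continuous_drift.integrableOn_Icc).add (hγ.integrableOn_mul hy)

theorem SolvesODE.sub_eq {γ y : ℝ → ℝ} (hγ : IsControl γ) (hy : SolvesODE γ y) {s t : ℝ}
    (hs : s ∈ Icc (1 : ℝ) 2) (ht : t ∈ Icc (1 : ℝ) 2) :
    y t - y s = ∫ τ in s..t, (drift τ + 2 * γ τ * y τ) := by
  have hi := hγ.integrableOn_rhs hy.1
  rw [hy.2 t ht, hy.2 s hs]
  exact intervalIntegral.integral_interval_sub_left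
    (intervalIntegrable_of_integrableOn_Icc hi one_mem ht)
    (intervalIntegrable_of_integrableOn_Icc hi one_mem hs)

/-- Grönwall applies to `-y`: the drift has the good sign, and `γ ≤ 1` bounds `γ (-y)` by the
positive part of `-y`. -/
theorem SolvesODE.nonneg {γ y : ℝ → ℝ} (hγ : IsControl γ) (hy : SolvesODE γ y) :
    ∀ t ∈ Icc (1 : ℝ) 2, 0 ≤ y t := by
  have := nonpos_of_le_integral_posPart (w := fun t => -y t) hy.1.neg fun t ht => by
    rw [hy.2 t ht, ← intervalIntegral.integral_neg]
    have hc : ContinuousOn (fun s => 2 * max (-y s) 0) (Icc 1 2) :=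
      continuousOn_const.mul (ContinuousOn.sup hy.1.neg continuousOn_const)
    refine intervalIntegral.integral_mono_on ht.1
      (intervalIntegrable_of_integrableOn_Icc (hγ.integrableOn_rhs hy.1) one_mem ht).neg
      (intervalIntegrable_of_integrableOn_Icc hc.integrableOn_Icc one_mem ht) fun s hs => ?_
    have hs' : s ∈ Icc (1 : ℝ) 2 := ⟨hs.1, hs.2.trans ht.2⟩
    have h1 := drift_nonneg hs'
    have h2 := hγ.2 s hs'
    have h3 : γ s * -y s ≤ max (-y s) 0 := by
      calc γ s * -y s ≤ γ s * max (-y s) 0 := mul_le_mul_of_nonneg_left (le_max_left _ _) h2.1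
        _ ≤ 1 * max (-y s) 0 := mul_le_mul_of_nonneg_right h2.2 (le_max_right _ _)
        _ = _ := one_mul _
    linarith
  exact fun t ht => by simpa using this t ht

theorem SolvesODE.rhs_nonneg {γ y : ℝ → ℝ} (hγ : IsControl γ) (hy : SolvesODE γ y) {t : ℝ}
    (ht : t ∈ Icc (1 : ℝ) 2) : 0 ≤ drift t + 2 * γ t * y t :=
  add_nonneg (drift_nonneg ht)
    (mul_nonneg (mul_nonneg zero_le_two (hγ.2 t ht).1) (hy.nonneg hγ t ht))

theorem SolvesODE.monotoneOn {γ y : ℝ → ℝ} (hγ : IsControl γ) (hy : SolvesODE γ y) :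
    MonotoneOn y (Icc 1 2) := by
  intro s hs t ht hst
  rw [← sub_nonneg, hy.sub_eq hγ hs ht]
  exact intervalIntegral.integral_nonneg hst fun τ hτ =>
    hy.rhs_nonneg hγ ⟨hs.1.trans hτ.1, hτ.2.trans ht.2⟩

/-- Comparison: a larger control gives a larger solution. -/
theorem SolvesODE.mono {γ γ' y y' : ℝ → ℝ} (hγ : IsControl γ) (hγ' : IsControl γ')
    (hy : SolvesODE γ y) (hy' : SolvesODE γ' y')
    (h : ∀ᵐ t ∂(volume.restrict (Icc (1 : ℝ) 2)), γ t ≤ γ' t) :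
    ∀ t ∈ Icc (1 : ℝ) 2, y t ≤ y' t := by
  have := nonpos_of_le_integral_posPart (w := fun t => y t - y' t) (hy.1.sub hy'.1) fun t ht => by
    have i1 := intervalIntegrable_of_integrableOn_Icc (hγ.integrableOn_rhs hy.1) one_mem ht
    have i2 := intervalIntegrable_of_integrableOn_Icc (hγ'.integrableOn_rhs hy'.1) one_mem ht
    rw [hy.2 t ht, hy'.2 t ht, ← intervalIntegral.integral_sub i1 i2]
    have hc : ContinuousOn (fun s => 2 * max (y s - y' s) 0) (Icc 1 2) :=
      continuousOn_const.mul (ContinuousOn.sup (hy.1.sub hy'.1) continuousOn_const)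
    refine intervalIntegral.integral_mono_ae_restrict ht.1 (i1.sub i2)
      (intervalIntegrable_of_integrableOn_Icc hc.integrableOn_Icc one_mem ht) ?_
    have hsub : Icc (1 : ℝ) t ⊆ Icc 1 2 := Icc_subset_Icc_right ht.2
    filter_upwards [ae_restrict_of_ae_restrict_of_subset hsub h,
      ae_restrict_mem measurableSet_Icc] with s hs hs1
    have hs' := hsub hs1
    have h2 := hγ.2 s hs'
    have h4 := hy'.nonneg hγ' s hs'
    have h3 : γ s * (y s - y' s) ≤ max (y s - y' s) 0 := by
      calc γ s * (y s - y' s) ≤ γ s * max (y s - y' s) 0 :=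
            mul_le_mul_of_nonneg_left (le_max_left _ _) h2.1
        _ ≤ 1 * max (y s - y' s) 0 := mul_le_mul_of_nonneg_right h2.2 (le_max_right _ _)
        _ = _ := one_mul _
    -- Changing the control only helps because `y'` is nonnegative.
    have h5 : (γ s - γ' s) * y' s ≤ 0 := mul_nonpos_of_nonpos_of_nonneg (by linarith) h4
    show drift s + 2 * γ s * y s - (drift s + 2 * γ' s * y' s) ≤ 2 * max (y s - y' s) 0
    linarith
  exact fun t ht => by simpa using this t ht

theorem SolvesODE.eqOn_of_ae_eq {γ γ' y y' : ℝ → ℝ} (hγ : IsControl γ) (hγ' : IsControl γ')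
    (hy : SolvesODE γ y) (hy' : SolvesODE γ' y')
    (h : ∀ᵐ t ∂(volume.restrict (Icc (1 : ℝ) 2)), γ t = γ' t) : EqOn y y' (Icc 1 2) :=
  fun t ht => le_antisymm (hy.mono hγ hγ' hy' (h.mono fun _ h => h.le) t ht)
    (hy'.mono hγ' hγ hy (h.mono fun _ h => h.ge) t ht)

theorem hasDerivAt_x₁ (t : ℝ) : HasDerivAt x₁ (drift t + 2 * x₁ t) t := by
  have h : HasDerivAt (fun t : ℝ => (t - 1) ^ 2) (2 * (t - 1)) t := by
    convert! ((hasDerivAt_id t).sub_const 1).pow 2 using 1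
    simp
  convert! h using 1
  unfold drift x₁
  ring

theorem x₁_sub_eq (s t : ℝ) : x₁ t - x₁ s = ∫ τ in s..t, (drift τ + 2 * x₁ τ) := by
  refine (intervalIntegral.integral_eq_sub_of_hasDerivAt (fun τ _ => hasDerivAt_x₁ τ) ?_).symm
  refine Continuous.intervalIntegrable ?_ _ _
  unfold drift x₁
  fun_prop

/-- The formula for the shrinking front continues past time `1` as the maximal solution, giving the
bound `y ≤ x₁ ≤ 1` for all controls. -/
theorem solvesODE_x₁ : SolvesODE (fun _ => 1) x₁ := by
  refine ⟨fun t _ => (hasDerivAt_x₁ t).continuousAt.continuousWithinAt, fun t _ => ?_⟩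
  have := x₁_sub_eq 1 t
  simpa [x₁] using this

theorem integral_drift (t : ℝ) :
    ∫ s in (1 : ℝ)..t, drift s = (t - 1) ^ 2 - 2 / 3 * (t - 1) ^ 3 := by
  have hd : ∀ s, HasDerivAt (fun t : ℝ => (t - 1) ^ 2 - 2 / 3 * (t - 1) ^ 3) (drift s) s := by
    intro s
    have h := (hasDerivAt_id s).sub_const 1
    convert! (h.pow 2).sub ((h.pow 3).const_mul (2 / 3)) using 1
    unfold drift
    simp
    ring
  rw [intervalIntegral.integral_eq_sub_of_hasDerivAt (fun s _ => hd s)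
    (continuous_drift.intervalIntegrable _ _)]
  norm_num

theorem solvesODE_zero :
    SolvesODE (fun _ => 0) fun t => (t - 1) ^ 2 - 2 / 3 * (t - 1) ^ 3 := by
  refine ⟨by fun_prop, fun t _ => ?_⟩
  simp only
  rw [← integral_drift]
  simp

theorem SolvesODE.le_x₁ {γ y : ℝ → ℝ} (hγ : IsControl γ) (hy : SolvesODE γ y) :
    ∀ t ∈ Icc (1 : ℝ) 2, y t ≤ x₁ t :=
  hy.mono hγ (isControl_const (by simp)) solvesODE_x₁
    ((ae_restrict_mem measurableSet_Icc).mono fun t ht => (hγ.2 t ht).2)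

theorem SolvesODE.le_one {γ y : ℝ → ℝ} (hγ : IsControl γ) (hy : SolvesODE γ y) {t : ℝ}
    (ht : t ∈ Icc (1 : ℝ) 2) : y t ≤ 1 := by
  refine (hy.le_x₁ hγ t ht).trans ?_
  unfold x₁
  nlinarith [ht.1, ht.2]

theorem SolvesODE.zero_le {γ y y₀ : ℝ → ℝ} (hγ : IsControl γ) (hy : SolvesODE γ y)
    (hy₀ : SolvesODE (fun _ => 0) y₀) : ∀ t ∈ Icc (1 : ℝ) 2, y₀ t ≤ y t :=
  hy₀.mono (isControl_const (by simp)) hγ hy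
    ((ae_restrict_mem measurableSet_Icc).mono fun t ht => (hγ.2 t ht).1)

theorem SolvesODE.pos {γ y : ℝ → ℝ} (hγ : IsControl γ) (hy : SolvesODE γ y) :
    ∀ t ∈ Ioc (1 : ℝ) 2, 0 < y t := by
  intro t ht
  refine lt_of_lt_of_le ?_ (hy.zero_le hγ solvesODE_zero t (Ioc_subset_Icc_self ht))
  have h : 0 < (t - 1) ^ 2 := by have := ht.1; exact pow_pos (by linarith) 2
  have : 0 < (t - 1) ^ 2 * (1 - 2 / 3 * (t - 1)) := mul_pos h (by linarith [ht.2])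
  linarith

theorem SolvesODE.one_eq_zero {γ y : ℝ → ℝ} (hy : SolvesODE γ y) : y 1 = 0 := by
  simpa using hy.2 1 one_mem

/-- Variation of constants: `y = exp Γ * H` with `Γ' = 2 γ` and `H' = exp (-Γ) * drift` almost
everywhere. Both factors are absolutely continuous, so the product rule integrates. -/
theorem IsControl.exists_solvesODE {γ : ℝ → ℝ} (hγ : IsControl γ) : ∃ y, SolvesODE γ y := by
  have hi : IntervalIntegrable (fun t => 2 * γ t) volume 1 2 :=
    intervalIntegrable_of_integrableOn_Icc (hγ.integrableOn.const_mul 2) one_mem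
      ⟨one_le_two, le_rfl⟩
  have hu : uIcc (1 : ℝ) 2 = Icc 1 2 := uIcc_of_le one_le_two
  set Γ : ℝ → ℝ := fun t => ∫ s in (1 : ℝ)..t, 2 * γ s with hΓ
  have hΓlip : LipschitzOnWith 2 Γ (Icc 1 2) := by
    refine LipschitzOnWith.of_dist_le_mul fun s hs t ht => ?_
    rw [dist_comm, Real.dist_eq, hΓ]
    simp only
    rw [intervalIntegral.integral_interval_sub_left
      (hi.mono_set (by rw [hu]; exact uIcc_subset_Icc one_mem ht))
      (hi.mono_set (by rw [hu]; exact uIcc_subset_Icc one_mem hs))]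
    have := intervalIntegral.norm_integral_le_of_norm_le_const (a := s) (b := t)
      (f := fun s => 2 * γ s) (C := 2) fun τ hτ => by
        have h := hγ.2 τ (uIcc_subset_Icc hs ht (uIoc_subset_uIcc hτ))
        rw [Real.norm_of_nonneg (by linarith [h.1])]
        linarith [h.2]
    rw [dist_comm, Real.dist_eq]
    simpa using this
  -- The exponential is Lipschitz on a ball containing the compact image of `Γ`, hence its
  -- composition with the Lipschitz `Γ` is Lipschitz.
  have hEac : AbsolutelyContinuousOnInterval (fun t => Real.exp (Γ t)) 1 2 := by
    have hc : IsCompact (Γ '' Icc 1 2) := isCompact_Icc.image_of_continuousOn hΓlip.continuousOn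
    obtain ⟨r, hr⟩ := hc.isBounded.subset_closedBall 0
    obtain ⟨K, hK⟩ := (Real.contDiff_exp (n := 1)).contDiffOn.exists_lipschitzOnWith
      (s := Metric.closedBall (0 : ℝ) r) (by decide) (convex_closedBall _ _)
      (isCompact_closedBall _ _)
    have h := hK.comp hΓlip fun t ht => hr (mem_image_of_mem _ ht)
    exact LipschitzOnWith.absolutelyContinuousOnInterval (hu ▸ h)
  have hΓc : ContinuousOn Γ (Icc 1 2) := hΓlip.continuousOn
  have hfc : ContinuousOn (fun t => Real.exp (-Γ t) * drift t) (Icc 1 2) :=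
    (Real.continuous_exp.comp_continuousOn hΓc.neg).mul continuous_drift.continuousOn
  have hfi : IntervalIntegrable (fun t => Real.exp (-Γ t) * drift t) volume 1 2 :=
    ContinuousOn.intervalIntegrable (hu ▸ hfc)
  have hHac := hfi.absolutelyContinuousOnInterval_intervalIntegral (c := 1) (by simp)
  set H : ℝ → ℝ := fun t => ∫ s in (1 : ℝ)..t, Real.exp (-Γ s) * drift s with hH
  refine ⟨fun t => Real.exp (Γ t) * H t, hu ▸ (hEac.fun_mul hHac).continuousOn, fun t ht => ?_⟩
  have hsub : uIcc 1 t ⊆ uIcc (1 : ℝ) 2 := by rw [hu]; exact uIcc_subset_Icc one_mem ht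
  have h := (hEac.mono hsub).integral_deriv_mul_eq_sub (hHac.mono hsub)
  have h1 : H 1 = 0 := by simp [hH]
  rw [h1, mul_zero, sub_zero] at h
  simp only
  rw [← h]
  refine intervalIntegral.integral_congr_ae ?_
  filter_upwards [hi.ae_hasDerivAt_integral, hfi.ae_hasDerivAt_integral] with s hs1 hs2 hs
  have hs' := hsub (uIoc_subset_uIcc hs)
  have d1 : deriv (fun t => Real.exp (Γ t)) s = Real.exp (Γ s) * (2 * γ s) :=
    (hs1 hs' 1 (by simp)).exp.deriv
  have d2 : deriv H s = Real.exp (-Γ s) * drift s := (hs2 hs' 1 (by simp)).deriv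
  have he : Real.exp (Γ s) * Real.exp (-Γ s) = 1 := by
    rw [← Real.exp_add, add_neg_cancel, Real.exp_zero]
  rw [d1, d2]
  linear_combination drift s * he

/-- Lebesgue differentiation equates the two right-hand sides almost everywhere; positivity of the
common solution allows division by it. -/
theorem SolvesODE.ae_eq_of_eqOn {γ γ' y y' : ℝ → ℝ} (hγ : IsControl γ) (hγ' : IsControl γ')
    (hy : SolvesODE γ y) (hy' : SolvesODE γ' y') (h : EqOn y y' (Icc 1 2)) :
    ∀ᵐ t ∂(volume.restrict (Icc (1 : ℝ) 2)), γ t = γ' t := by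
  have h2 : (2 : ℝ) ∈ Icc (1 : ℝ) 2 := ⟨one_le_two, le_rfl⟩
  have i1 := intervalIntegrable_of_integrableOn_Icc (hγ.integrableOn_rhs hy.1) one_mem h2
  have i2 := intervalIntegrable_of_integrableOn_Icc (hγ'.integrableOn_rhs hy'.1) one_mem h2
  have hu : uIcc (1 : ℝ) 2 = Icc 1 2 := uIcc_of_le one_le_two
  rw [restrict_Ioo_eq_restrict_Icc.symm, ae_restrict_iff' measurableSet_Ioo]
  filter_upwards [i1.ae_hasDerivAt_integral, i2.ae_hasDerivAt_integral] with t d1 d2 ht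
  have ht' := Ioo_subset_Icc_self ht
  have e1 := d1 (hu ▸ ht') 1 (by simp)
  have e2 := d2 (hu ▸ ht') 1 (by simp)
  have heq : (fun t => ∫ s in (1 : ℝ)..t, (drift s + 2 * γ s * y s)) =ᶠ[𝓝 t]
      fun t => ∫ s in (1 : ℝ)..t, (drift s + 2 * γ' s * y' s) := by
    filter_upwards [Icc_mem_nhds ht.1 ht.2] with s hs
    rw [← hy.2 s hs, ← hy'.2 s hs, h hs]
  have := e1.unique (e2.congr_of_eventuallyEq heq)
  have hp := hy'.pos hγ' t (Ioo_subset_Ioc_self ht)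
  rw [h ht'] at this
  have h3 : 2 * γ t * y' t = 2 * γ' t * y' t := by linarith
  have := mul_right_cancel₀ hp.ne' h3
  linarith

/-! ## The Hopf-Lax construction for radially nonincreasing data -/

/-- The infimum is attained at the point of the ball farthest from the origin; for the supremum
below it is the nearest one. -/
theorem infBall_of_antitone {f W : ℝ → ℝ} (hW : Antitone W) (hf : ∀ z, f z = W |z|) {r : ℝ}
    (hr : 0 ≤ r) (x : ℝ) : infBall f r x = W (|x| + r) := by
  refine IsLeast.csInf_eq ⟨?_, ?_⟩
  · rcases le_total 0 x with hx | hx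
    · refine ⟨x + r, by simp [abs_of_nonneg hr], ?_⟩
      rw [hf, abs_of_nonneg (add_nonneg hx hr), abs_of_nonneg hx]
    · refine ⟨x - r, by simp [abs_of_nonneg hr], ?_⟩
      rw [hf, abs_of_nonpos (by linarith), abs_of_nonpos hx]
      congr 1
      ring
  · rintro _ ⟨z, hz, rfl⟩
    rw [hf]
    refine hW ?_
    rw [Metric.mem_closedBall, Real.dist_eq] at hz
    linarith [abs_sub_abs_le_abs_sub z x]

theorem supBall_of_antitone {f W : ℝ → ℝ} (hW : Antitone W) (hf : ∀ z, f z = W |z|) {r : ℝ}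
    (hr : 0 ≤ r) (x : ℝ) : supBall f r x = W (max (|x| - r) 0) := by
  refine IsGreatest.csSup_eq ⟨?_, ?_⟩
  · rcases le_total |x| r with hx | hx
    · refine ⟨0, by simpa [Real.dist_eq] using hx, ?_⟩
      rw [hf, abs_zero, max_eq_right (by linarith)]
    · rw [max_eq_left (by linarith)]
      rcases le_total 0 x with h0 | h0
      · rw [abs_of_nonneg h0] at hx ⊢
        refine ⟨x - r, by simp [abs_of_nonneg hr], ?_⟩
        rw [hf, abs_of_nonneg (by linarith)]
      · rw [abs_of_nonpos h0] at hx ⊢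
        refine ⟨x + r, by simp [abs_of_nonneg hr], ?_⟩
        rw [hf, abs_of_nonpos (by linarith)]
        congr 1
        ring
  · rintro _ ⟨z, hz, rfl⟩
    rw [hf]
    refine hW ?_
    rw [Metric.mem_closedBall, Real.dist_eq] at hz
    have := abs_sub_abs_le_abs_sub x z
    rw [abs_sub_comm x z] at this
    exact max_le (by linarith) (abs_nonneg z)

theorem x₁_nonneg (t : ℝ) : 0 ≤ x₁ t := sq_nonneg _

theorem x₁_le_one {t : ℝ} (ht : t ∈ Icc (0 : ℝ) 2) : x₁ t ≤ 1 := by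
  unfold x₁
  nlinarith [ht.1, ht.2]

/-- The position of the (outer) front: `x₁` up to time `1`, then `y`. -/
noncomputable def front (y : ℝ → ℝ) (t : ℝ) : ℝ := if t ≤ 1 then x₁ t else y t

/-- The maximum of the solution at time `t`. -/
noncomputable def plateau (t : ℝ) : ℝ := if t ≤ 1 then x₁ t else 0

/-- The explicit form of the Hopf-Lax function with datum `datum`. -/
noncomputable def profile (y : ℝ → ℝ) (x t : ℝ) : ℝ := min (plateau t) (front y t - |x|)

theorem plateau_nonneg (t : ℝ) : 0 ≤ plateau t := by
  unfold plateau; split_ifs <;> simp [x₁_nonneg]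

/-- Keeping `W` general treats the datum and its truncation at once: both phases act on the radial
variable only. -/
theorem hopfLax_of_antitone {w W y : ℝ → ℝ} (hW : Antitone W) (hw : ∀ z, w z = W |z|)
    (hy : ∀ t ∈ Icc (1 : ℝ) 2, 0 ≤ y t) (x : ℝ) {t : ℝ} (ht : t ∈ Icc (0 : ℝ) 2) :
    hopfLax w y x t = W (1 - profile y x t) := by
  unfold hopfLax profile plateau front
  split_ifs with h
  · rw [infBall_of_antitone hW hw (by linarith [x₁_le_one ht]),
      min_eq_right (by linarith [abs_nonneg x])]
    congr 1
    ring
  · have hW1 : Antitone fun s => W (s + 1) := fun a b hab => hW (by linarith)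
    rw [supBall_of_antitone hW1 (fun z => by
      rw [infBall_of_antitone hW hw (by simp [x₁])]
      simp [x₁]) (hy t ⟨(not_le.1 h).le, ht.2⟩)]
    congr 1
    rcases le_total |x| (y t) with hx | hx
    · rw [max_eq_right (by linarith), min_eq_left (by linarith)]
      ring
    · rw [max_eq_left (by linarith), min_eq_right (by linarith)]
      ring

theorem hopfLax_datum {y : ℝ → ℝ} (hy : ∀ t ∈ Icc (1 : ℝ) 2, 0 ≤ y t) (x : ℝ) {t : ℝ}
    (ht : t ∈ Icc (0 : ℝ) 2) : hopfLax datum y x t = profile y x t := by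
  rw [hopfLax_of_antitone (w := datum) (W := fun s => 1 - s) (fun a b h => by simp only; linarith)
    (fun z => rfl) hy x ht]
  ring

theorem hopfLax_truncatedDatum {y : ℝ → ℝ} (hy : ∀ t ∈ Icc (1 : ℝ) 2, 0 ≤ y t) (x : ℝ) {t : ℝ}
    (ht : t ∈ Icc (0 : ℝ) 2) : hopfLax truncatedDatum y x t = max (profile y x t) (-1) := by
  rw [hopfLax_of_antitone (w := truncatedDatum) (W := fun s => max (1 - s) (-1))
    (fun a b h => max_le_max_right _ (by linarith)) (fun z => rfl) hy x ht]
  congr 1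
  ring

theorem profile_of_le {y : ℝ → ℝ} {t : ℝ} (ht : t ≤ 1) (x : ℝ) : profile y x t = x₁ t - |x| := by
  unfold profile plateau front
  rw [if_pos ht, if_pos ht, min_eq_right (by linarith [abs_nonneg x])]

theorem SolvesODE.profile_of_ge {γ y : ℝ → ℝ} (hy : SolvesODE γ y) {t : ℝ} (ht : 1 ≤ t) (x : ℝ) :
    profile y x t = min 0 (y t - |x|) := by
  rcases ht.eq_or_lt with rfl | ht
  · rw [profile_of_le le_rfl, hy.one_eq_zero, min_eq_right (by simp)]
    simp [x₁]
  · unfold profile plateau front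
    rw [if_neg (not_le.2 ht), if_neg (not_le.2 ht)]

theorem setOf_profile_pos_of_le {y : ℝ → ℝ} {t : ℝ} (ht : t ≤ 1) :
    {x | 0 < profile y x t} = Ioo (-x₁ t) (x₁ t) := by
  ext x
  simp only [mem_ofPred_eq, profile_of_le ht, mem_Ioo, sub_pos, abs_lt]

theorem setOf_profile_nonneg_of_le {y : ℝ → ℝ} {t : ℝ} (ht : t ≤ 1) :
    {x | 0 ≤ profile y x t} = Icc (-x₁ t) (x₁ t) := by
  ext x
  simp only [mem_ofPred_eq, profile_of_le ht, mem_Icc, sub_nonneg, abs_le]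

theorem SolvesODE.profile_nonpos {γ y : ℝ → ℝ} (hy : SolvesODE γ y) {t : ℝ} (ht : 1 ≤ t) (x : ℝ) :
    profile y x t ≤ 0 := by
  rw [hy.profile_of_ge ht]
  exact min_le_left _ _

theorem SolvesODE.setOf_profile_nonneg {γ y : ℝ → ℝ} (hy : SolvesODE γ y) {t : ℝ} (ht : 1 ≤ t) :
    {x | 0 ≤ profile y x t} = Icc (-y t) (y t) := by
  ext x
  simp only [mem_ofPred_eq, hy.profile_of_ge ht, mem_Icc, le_min_iff, le_refl, true_and, sub_nonneg,
    abs_le]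

theorem SolvesODE.setOf_profile_eq_zero {γ y : ℝ → ℝ} (hy : SolvesODE γ y) {t : ℝ} (ht : 1 ≤ t) :
    {x | profile y x t = 0} = Icc (-y t) (y t) := by
  rw [← hy.setOf_profile_nonneg ht]
  ext x
  exact ⟨fun h => h.ge, fun h => le_antisymm (hy.profile_nonpos ht x) h⟩

/-! ### Integrability and mass of `chi`. -/

theorem chi_eq_mul_indicator {γ y : ℝ → ℝ} (x t : ℝ) : chi γ y x t =
    (if t < 1 then 1 else γ t) *
      (Icc (-(if t < 1 then x₁ t else y t)) (if t < 1 then x₁ t else y t)).indicator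
        (fun _ => (1 : ℝ)) x := by
  unfold chi
  split_ifs with h
  · simp
  · by_cases hx : x ∈ Icc (-y t) (y t) <;> simp [hx]

theorem integrable_chi (γ y : ℝ → ℝ) (t : ℝ) : Integrable fun x => chi γ y x t := by
  simp_rw [chi_eq_mul_indicator]
  refine Integrable.const_mul ?_ _
  exact (integrable_indicator_iff measurableSet_Icc).2 (by simp)

theorem integral_chi_of_lt (γ y : ℝ → ℝ) {t : ℝ} (ht : t < 1) :
    ∫ x, chi γ y x t = 2 * x₁ t := by
  simp only [chi, if_pos ht]
  rw [integral_indicator_const _ measurableSet_Icc]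
  have := x₁_nonneg t
  simp [Measure.real, ENNReal.toReal_ofReal (show 0 ≤ x₁ t + x₁ t by linarith)]
  ring

theorem integral_chi_of_ge (γ : ℝ → ℝ) {y : ℝ → ℝ} {t : ℝ} (ht : 1 ≤ t) (hy : 0 ≤ y t) :
    ∫ x, chi γ y x t = 2 * γ t * y t := by
  simp only [chi, if_neg (not_lt.2 ht)]
  rw [integral_indicator_const _ measurableSet_Icc]
  simp [Measure.real, ENNReal.toReal_ofReal (show 0 ≤ y t + y t by linarith)]
  ring

/-! ## Test functions along curves -/

/-- If `v - ∫ b - φ` has a local maximum at `(x₀,t₀)` and `v` decreases, backwards along a Lipschitz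
curve through that point, at a rate at most `e` (up to the first-order change of `φ`), then
`∂φ/∂t` is bounded by every continuous majorant of `e - b`. -/
theorem deriv_time_le_of_isLocalMax {v : ℝ → ℝ → ℝ} {φ : ℝ × ℝ → ℝ} {b e g ξ : ℝ → ℝ}
    {x₀ t₀ p q K : ℝ} {f' : ℝ × ℝ →L[ℝ] ℝ} (ht₀ : t₀ ∈ Ioo (0 : ℝ) 2)
    (hφ : HasFDerivAt φ f' (x₀, t₀)) (hp : f' (1, 0) = p) (hq : f' (0, 1) = q)
    (hb : IntegrableOn b (Ioo 0 2)) (he : IntegrableOn e (Ioo 0 2)) (hg : ContinuousAt g t₀)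
    (hmax : ∀ᶠ z : ℝ × ℝ in 𝓝 (x₀, t₀), v z.1 z.2 - (∫ s in (0 : ℝ)..z.2, b s) - φ z ≤
      v x₀ t₀ - (∫ s in (0 : ℝ)..t₀, b s) - φ (x₀, t₀))
    (hle : ∃ ε > 0, ∀ᵐ t ∂(volume.restrict (Ioo (0 : ℝ) 2)), |t - t₀| < ε → e t - b t ≤ g t)
    (hξ : ∀ᶠ s in 𝓝[<] t₀, |ξ s - x₀| ≤ K * (t₀ - s))
    (hv : ∀ᶠ s in 𝓝[<] t₀, v x₀ t₀ - v (ξ s) s - p * (x₀ - ξ s) ≤ ∫ τ in s..t₀, e τ) :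
    q ≤ g t₀ := by
  by_contra! hlt
  -- Two errors of size `η` occur, one from the continuity of `g` and one from the linearization of
  -- `φ`; a third is left over for the contradiction.
  set η := (q - g t₀) / 3 with hη
  have hηpos : 0 < η := by rw [hη]; linarith
  obtain ⟨ε, hε, hae⟩ := hle
  have hgη : ∀ᶠ t in 𝓝 t₀, g t < g t₀ + η := hg.eventually_lt_const (by linarith)
  obtain ⟨δ, hδ, hδg⟩ := Metric.eventually_nhds_iff.1 hgη
  -- In the sup norm the curve at time `s` is within `K' (t₀ - s)` of the base point, the `1`
  -- accounting for the time component.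
  set K' := max K 1
  have hK' : 0 < K' := lt_of_lt_of_le one_pos (le_max_right _ _)
  have hcurve : Tendsto (fun s => (ξ s, s)) (𝓝[<] t₀) (𝓝 (x₀, t₀)) := by
    refine Tendsto.prodMk_nhds ?_ (tendsto_id.mono_left nhdsWithin_le_nhds)
    rw [tendsto_iff_norm_sub_tendsto_zero]
    refine squeeze_zero' (Eventually.of_forall fun _ => norm_nonneg _) hξ ?_
    have : Tendsto (fun s => K * (t₀ - s)) (𝓝 t₀) (𝓝 (K * (t₀ - t₀))) :=
      Continuous.tendsto (by fun_prop) _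
    rw [sub_self, mul_zero] at this
    exact this.mono_left nhdsWithin_le_nhds
  have hlin := hcurve.eventually (hφ.isLittleO.def (c := η / K') (by positivity))
  have h0 : ∀ᶠ s in 𝓝[<] t₀, 0 < s := nhdsWithin_le_nhds (lt_mem_nhds ht₀.1)
  have hεs : ∀ᶠ s in 𝓝[<] t₀, t₀ - min ε δ < s :=
    nhdsWithin_le_nhds (lt_mem_nhds (by have := lt_min hε hδ; linarith))
  obtain ⟨s, hmax, hξ, hv, hlin, hs0, hsε, hst⟩ := ((hcurve.eventually hmax).and
    (hξ.and (hv.and (hlin.and (h0.and (hεs.and self_mem_nhdsWithin)))))).exists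
  change s < t₀ at hst
  have hsub : ∀ f : ℝ → ℝ, IntegrableOn f (Ioo 0 2) → ∀ a ∈ Icc 0 t₀,
      IntervalIntegrable f volume a t₀ := by
    intro f hf a ha
    rw [← integrableOn_Icc_iff_integrableOn_Ioo] at hf
    rw [intervalIntegrable_iff]
    refine hf.mono_set (uIoc_subset_uIcc.trans (uIcc_subset_Icc ⟨ha.1, ha.2.trans ht₀.2.le⟩
      ⟨ht₀.1.le, ht₀.2.le⟩))
  have hs_mem : s ∈ Icc 0 t₀ := ⟨hs0.le, hst.le⟩
  have hbi := hsub b hb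
  have hei := hsub e he s hs_mem
  have hsplit : (∫ τ in (0 : ℝ)..t₀, b τ) - ∫ τ in (0 : ℝ)..s, b τ = ∫ τ in s..t₀, b τ :=
    intervalIntegral.integral_interval_sub_left (hbi 0 ⟨le_rfl, ht₀.1.le⟩)
      ((hbi 0 ⟨le_rfl, ht₀.1.le⟩).trans (hbi s hs_mem).symm)
  have hmono : ∫ τ in s..t₀, (e τ - b τ) ≤ ∫ _ in s..t₀, (g t₀ + η) := by
    refine intervalIntegral.integral_mono_ae_restrict hst.le (hei.sub (hbi s hs_mem))
      intervalIntegrable_const ?_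
    have hsubset : Icc s t₀ ⊆ Ioo (0 : ℝ) 2 :=
      fun τ hτ => ⟨hs0.trans_le hτ.1, hτ.2.trans_lt ht₀.2⟩
    filter_upwards [ae_restrict_of_ae_restrict_of_subset hsubset hae,
      ae_restrict_mem measurableSet_Icc] with τ hτ hτs
    have hd : |τ - t₀| < min ε δ := by
      rw [abs_of_nonpos (by linarith [hτs.2])]
      linarith [hτs.1]
    exact (hτ (hd.trans_le (min_le_left _ _))).trans
      (hδg (by rw [Real.dist_eq]; exact hd.trans_le (min_le_right _ _))).le
  rw [intervalIntegral.integral_sub hei (hbi s hs_mem), intervalIntegral.integral_const,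
    smul_eq_mul] at hmono
  have hf' : f' ((ξ s, s) - (x₀, t₀)) = p * (ξ s - x₀) + q * (s - t₀) := by
    have : ((ξ s, s) - (x₀, t₀) : ℝ × ℝ) = (ξ s - x₀) • (1, 0) + (s - t₀) • (0, 1) := by
      ext <;> simp
    rw [this, map_add, map_smul, map_smul, hp, hq]
    simp only [smul_eq_mul]
    ring
  have hnorm : ‖((ξ s, s) - (x₀, t₀) : ℝ × ℝ)‖ ≤ K' * (t₀ - s) := by
    rw [Prod.norm_def]
    refine max_le (hξ.trans ?_) ?_
    · exact mul_le_mul_of_nonneg_right (le_max_left _ _) (by linarith)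
    · simp only [Prod.snd_sub, Real.norm_eq_abs]
      rw [abs_of_nonpos (by linarith)]
      nlinarith [le_max_right K 1]
  have hlin' : |φ (ξ s, s) - φ (x₀, t₀) - (p * (ξ s - x₀) + q * (s - t₀))| ≤ η * (t₀ - s) := by
    rw [← hf', ← Real.norm_eq_abs]
    refine hlin.trans ((mul_le_mul_of_nonneg_left hnorm (by positivity)).trans_eq ?_)
    field_simp
  have h1 := (abs_le.1 hlin').2
  simp only at hmax
  have h3 : 3 * η = q - g t₀ := by rw [hη]; ring
  have : q * (t₀ - s) ≤ (g t₀ + 2 * η) * (t₀ - s) := by linarith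
  have := le_of_mul_le_mul_right this (by linarith)
  linarith

/-- A bound for a directional derivative from a one-sided bound. -/
theorem mul_deriv_le {f : ℝ → ℝ} {x₀ p σ k : ℝ} (hf : HasDerivAt f p x₀)
    (h : ∀ᶠ s in 𝓝[>] (0 : ℝ), f (x₀ + σ * s) - f x₀ ≤ k * s) : σ * p ≤ k := by
  have hl : HasDerivAt (fun s : ℝ => x₀ + σ * s) σ 0 := by
    simpa using ((hasDerivAt_id (0 : ℝ)).const_mul σ).const_add x₀
  have hg : HasDerivAt (fun s : ℝ => f (x₀ + σ * s)) (p * σ) 0 :=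
    HasDerivAt.comp (0 : ℝ) (h₂ := f) (by simpa using hf) hl
  have ht := (hasDerivAt_iff_tendsto_slope.1 hg).mono_left
    (nhdsWithin_mono (0 : ℝ) (show Ioi (0 : ℝ) ⊆ {0}ᶜ from fun s hs => ne_of_gt hs))
  rw [mul_comm]
  refine le_of_tendsto ht ?_
  filter_upwards [h, self_mem_nhdsWithin] with s hs hs0
  rw [slope_def_field]
  simp only [mul_zero, add_zero, sub_zero]
  exact (div_le_iff₀ hs0).2 hs

theorem le_mul_deriv {f : ℝ → ℝ} {x₀ p σ k : ℝ} (hf : HasDerivAt f p x₀)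
    (h : ∀ᶠ s in 𝓝[>] (0 : ℝ), k * s ≤ f (x₀ + σ * s) - f x₀) : k ≤ σ * p := by
  have := mul_deriv_le (σ := σ) (k := -k) hf.neg (by
    filter_upwards [h] with s hs
    simp only [Pi.neg_apply]
    linarith)
  linarith

/-- The requirement of an `L¹`-viscosity subsolution at one point. -/
noncomputable def SubsolutionAt (c v : ℝ → ℝ → ℝ) (x₀ t₀ : ℝ) : Prop :=
  ∀ (b : ℝ → ℝ) (φ : ℝ × ℝ → ℝ) (G : ℝ × ℝ × ℝ → ℝ),
    IntegrableOn b (Ioo 0 2) →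
    ContDiffOn ℝ ∞ φ (univ ×ˢ Ioo 0 2) →
    ContinuousOn G (univ ×ˢ Ioo 0 2 ×ˢ univ) →
    IsLocalMaxOn (fun z : ℝ × ℝ => v z.1 z.2 - (∫ s in (0 : ℝ)..z.2, b s) - φ z)
      (univ ×ˢ Ioo 0 2) (x₀, t₀) →
    (∃ ε > 0, ∀ᵐ t ∂(volume.restrict (Ioo 0 2)), |t - t₀| < ε →
      ∀ x p, |x - x₀| < ε → |p - deriv (fun x => φ (x, t₀)) x₀| < ε →
        c x t * |p| - b t ≤ G (x, t, p)) →
    deriv (fun t => φ (x₀, t)) t₀ ≤ G (x₀, t₀, deriv (fun x => φ (x, t₀)) x₀)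

/-- The requirement of an `L¹`-viscosity supersolution at one point. -/
noncomputable def SupersolutionAt (c v : ℝ → ℝ → ℝ) (x₀ t₀ : ℝ) : Prop :=
  ∀ (b : ℝ → ℝ) (φ : ℝ × ℝ → ℝ) (G : ℝ × ℝ × ℝ → ℝ),
    IntegrableOn b (Ioo 0 2) →
    ContDiffOn ℝ ∞ φ (univ ×ˢ Ioo 0 2) →
    ContinuousOn G (univ ×ˢ Ioo 0 2 ×ˢ univ) →
    IsLocalMinOn (fun z : ℝ × ℝ => v z.1 z.2 - (∫ s in (0 : ℝ)..z.2, b s) - φ z)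
      (univ ×ˢ Ioo 0 2) (x₀, t₀) →
    (∃ ε > 0, ∀ᵐ t ∂(volume.restrict (Ioo 0 2)), |t - t₀| < ε →
      ∀ x p, |x - x₀| < ε → |p - deriv (fun x => φ (x, t₀)) x₀| < ε →
        G (x, t, p) ≤ c x t * |p| - b t) →
    G (x₀, t₀, deriv (fun x => φ (x, t₀)) x₀) ≤ deriv (fun t => φ (x₀, t)) t₀

/-- The test sees only the germ of the function, so explicit formulas may be substituted locally. -/
theorem SubsolutionAt.congr {c v w : ℝ → ℝ → ℝ} {x₀ t₀ : ℝ} (h : SubsolutionAt c v x₀ t₀)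
    (hvw : ∀ᶠ z : ℝ × ℝ in 𝓝 (x₀, t₀), w z.1 z.2 = v z.1 z.2) : SubsolutionAt c w x₀ t₀ := by
  intro b φ G hb hφ hG hmax hc
  refine h b φ G hb hφ hG ?_ hc
  have h0 : w x₀ t₀ = v x₀ t₀ := hvw.self_of_nhds
  filter_upwards [hmax, nhdsWithin_le_nhds hvw] with z hz hz'
  simpa only [hz', h0] using hz

theorem SupersolutionAt.congr {c v w : ℝ → ℝ → ℝ} {x₀ t₀ : ℝ} (h : SupersolutionAt c v x₀ t₀)
    (hvw : ∀ᶠ z : ℝ × ℝ in 𝓝 (x₀, t₀), w z.1 z.2 = v z.1 z.2) : SupersolutionAt c w x₀ t₀ := by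
  intro b φ G hb hφ hG hmin hc
  refine h b φ G hb hφ hG ?_ hc
  have h0 : w x₀ t₀ = v x₀ t₀ := hvw.self_of_nhds
  filter_upwards [hmin, nhdsWithin_le_nhds hvw] with z hz hz'
  simpa only [hz', h0] using hz

theorem eventually_mem_strip {x₀ t₀ : ℝ} (ht₀ : t₀ ∈ Ioo (0 : ℝ) 2) :
    (univ : Set ℝ) ×ˢ Ioo (0 : ℝ) 2 ∈ 𝓝 (x₀, t₀) :=
  prod_mem_nhds univ_mem (Ioo_mem_nhds ht₀.1 ht₀.2)

/-- The space and time derivatives of a test function. -/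
theorem exists_hasFDerivAt_of_contDiffOn {φ : ℝ × ℝ → ℝ} {x₀ t₀ : ℝ} (ht₀ : t₀ ∈ Ioo (0 : ℝ) 2)
    (hφ : ContDiffOn ℝ ∞ φ (univ ×ˢ Ioo 0 2)) :
    ∃ f' : ℝ × ℝ →L[ℝ] ℝ, HasFDerivAt φ f' (x₀, t₀) ∧
      HasDerivAt (fun x => φ (x, t₀)) (f' (1, 0)) x₀ ∧
      HasDerivAt (fun t => φ (x₀, t)) (f' (0, 1)) t₀ := by
  have hd : DifferentiableAt ℝ φ (x₀, t₀) :=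
    (hφ.contDiffAt (eventually_mem_strip ht₀)).differentiableAt (by simp)
  refine ⟨_, hd.hasFDerivAt, ?_, ?_⟩
  · exact HasFDerivAt.comp_hasDerivAt x₀ (l := φ) hd.hasFDerivAt
      ((hasDerivAt_id x₀).prodMk (hasDerivAt_const x₀ t₀))
  · exact HasFDerivAt.comp_hasDerivAt t₀ (l := φ) hd.hasFDerivAt
      ((hasDerivAt_const t₀ x₀).prodMk (hasDerivAt_id t₀))

/-- Criterion for the subsolution property at a point. The slope `p` is any number for which
`v(·,t₀) - φ` may have a local maximum at `x₀` with `φ' (x₀) = p`. -/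
theorem subsolutionAt_of_curve {c v : ℝ → ℝ → ℝ} {C : ℝ → ℝ} {x₀ t₀ : ℝ}
    (ht₀ : t₀ ∈ Ioo (0 : ℝ) 2) (hC : IntegrableOn C (Ioo 0 2))
    (h : ∀ (f : ℝ → ℝ) (p : ℝ), HasDerivAt f p x₀ →
      (∀ᶠ x in 𝓝 x₀, v x t₀ - v x₀ t₀ ≤ f x - f x₀) →
      (∀ᵐ t ∂(volume.restrict (Ioo 0 2)), c x₀ t * |p| = C t * |p|) ∧
      ∃ (ξ : ℝ → ℝ) (K : ℝ), (∀ᶠ s in 𝓝[<] t₀, |ξ s - x₀| ≤ K * (t₀ - s)) ∧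
        ∀ᶠ s in 𝓝[<] t₀, v x₀ t₀ - v (ξ s) s - p * (x₀ - ξ s) ≤ |p| * ∫ τ in s..t₀, C τ) :
    SubsolutionAt c v x₀ t₀ := by
  intro b φ G hb hφ hG hmax hc
  obtain ⟨f', hf', hx, ht⟩ := exists_hasFDerivAt_of_contDiffOn (x₀ := x₀) ht₀ hφ
  rw [hx.deriv] at hc ⊢
  rw [ht.deriv]
  have hmax' : ∀ᶠ z : ℝ × ℝ in 𝓝 (x₀, t₀), v z.1 z.2 - (∫ s in (0 : ℝ)..z.2, b s) - φ z ≤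
      v x₀ t₀ - (∫ s in (0 : ℝ)..t₀, b s) - φ (x₀, t₀) := by
    have := hmax
    rwa [IsLocalMaxOn, IsMaxFilter, nhdsWithin_eq_nhds.2 (eventually_mem_strip ht₀)] at this
  obtain ⟨hcC, ξ, K, hξ, hv⟩ := h _ _ hx (by
    have hcont : Tendsto (fun x : ℝ => (x, t₀)) (𝓝 x₀) (𝓝 (x₀, t₀)) :=
      Continuous.tendsto (by fun_prop) x₀
    filter_upwards [hcont.eventually hmax'] with x hx
    linarith)
  refine deriv_time_le_of_isLocalMax (e := fun t => |f' (1, 0)| * C t)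
    (g := fun t => G (x₀, t, f' (1, 0))) ht₀ hf' rfl rfl hb (hC.const_mul _) ?_ hmax' ?_ hξ ?_
  · have hGc : ContinuousAt G (x₀, t₀, f' (1, 0)) := hG.continuousAt
      (prod_mem_nhds univ_mem (prod_mem_nhds (Ioo_mem_nhds ht₀.1 ht₀.2) univ_mem))
    exact ContinuousAt.comp (g := G) hGc (by fun_prop)
  · obtain ⟨ε, hε, hae⟩ := hc
    refine ⟨ε, hε, ?_⟩
    filter_upwards [hae, hcC] with t h1 h2 h3
    -- The bound by `G` is needed only at the base point and at the slope of `φ`; no regularity of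
    -- `c` in space enters.
    have := h1 h3 x₀ (f' (1, 0)) (by simpa using hε) (by simpa using hε)
    rw [h2] at this
    linarith
  · filter_upwards [hv] with s hs
    rwa [intervalIntegral.integral_const_mul]

/-- Follows from the subsolution criterion by the symmetry that negates `v`, `c`, `b`, `φ` and
replaces `G(x,t,p)` by `-G(x,t,-p)`. -/
theorem supersolutionAt_of_curve {c v : ℝ → ℝ → ℝ} {C : ℝ → ℝ} {x₀ t₀ : ℝ}
    (ht₀ : t₀ ∈ Ioo (0 : ℝ) 2) (hC : IntegrableOn C (Ioo 0 2))
    (h : ∀ (f : ℝ → ℝ) (p : ℝ), HasDerivAt f p x₀ →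
      (∀ᶠ x in 𝓝 x₀, f x - f x₀ ≤ v x t₀ - v x₀ t₀) →
      (∀ᵐ t ∂(volume.restrict (Ioo 0 2)), c x₀ t * |p| = C t * |p|) ∧
      ∃ (ξ : ℝ → ℝ) (K : ℝ), (∀ᶠ s in 𝓝[<] t₀, |ξ s - x₀| ≤ K * (t₀ - s)) ∧
        ∀ᶠ s in 𝓝[<] t₀, |p| * (∫ τ in s..t₀, C τ) ≤ v x₀ t₀ - v (ξ s) s - p * (x₀ - ξ s)) :
    SupersolutionAt c v x₀ t₀ := by
  intro b φ G hb hφ hG hmin hc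
  have key : SubsolutionAt (fun x t => -c x t) (fun x t => -v x t) x₀ t₀ := by
    refine subsolutionAt_of_curve (C := fun t => -C t) ht₀ hC.neg fun f p hf hle => ?_
    obtain ⟨hcC, ξ, K, hξ, hv⟩ := h _ _ hf.neg (by
      filter_upwards [hle] with x hx
      simp only [Pi.neg_apply]
      linarith)
    rw [abs_neg] at hcC hv
    refine ⟨?_, ξ, K, hξ, ?_⟩
    · filter_upwards [hcC] with t ht
      linarith
    · filter_upwards [hv] with s hs
      rw [intervalIntegral.integral_neg]
      linarith
  have hder : ∀ (f : ℝ → ℝ) (x : ℝ), deriv (fun y => -f y) x = -deriv f x :=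
    fun f x => deriv.fun_neg
  have := key (fun t => -b t) (fun z => -φ z) (fun w => -G (w.1, w.2.1, -w.2.2)) hb.neg hφ.neg
    (hG.comp (f := fun w : ℝ × ℝ × ℝ => (w.1, w.2.1, -w.2.2)) (by fun_prop)
      (fun w hw => ⟨hw.1, hw.2.1, mem_univ _⟩)).neg
    (by
      filter_upwards [hmin] with z hz
      simp only [intervalIntegral.integral_neg]
      linarith)
    (by
      obtain ⟨ε, hε, hae⟩ := hc
      refine ⟨ε, hε, ?_⟩
      filter_upwards [hae] with t ht h1 x p hx hp
      have := ht h1 x (-p) hx (by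
        rw [hder (fun x => φ (x, t₀))] at hp
        rwa [← abs_neg, neg_sub, sub_neg_eq_add, add_comm, ← sub_neg_eq_add])
      rw [abs_neg] at this
      linarith)
  simp only [hder (fun x => φ (x, t₀)), hder (fun t => φ (x₀, t)), neg_neg] at this
  linarith

/-! ## The speed of the front -/

/-- The velocity of the front. -/
noncomputable def speed (γ y : ℝ → ℝ) (t : ℝ) : ℝ :=
  if t < 1 then drift t + 2 * x₁ t else drift t + 2 * γ t * y t

/-- Both branches agree at time `1`, since `y` and `x₁` vanish there. -/
theorem SolvesODE.speed_of_le {γ y : ℝ → ℝ} (hy : SolvesODE γ y) {t : ℝ} (ht : t ≤ 1) :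
    speed γ y t = drift t + 2 * x₁ t := by
  rcases ht.lt_or_eq with h | rfl
  · exact if_pos h
  · rw [speed, if_neg (lt_irrefl _), hy.one_eq_zero]
    simp [x₁]

theorem speed_of_ge {γ y : ℝ → ℝ} {t : ℝ} (ht : 1 ≤ t) :
    speed γ y t = drift t + 2 * γ t * y t := if_neg (not_lt.2 ht)

theorem SolvesODE.speed_nonneg {γ y : ℝ → ℝ} (hγ : IsControl γ) (hy : SolvesODE γ y) {t : ℝ}
    (ht : t ∈ Icc (1 : ℝ) 2) : 0 ≤ speed γ y t := by
  rw [speed_of_ge ht.1]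
  exact hy.rhs_nonneg hγ ht

theorem SolvesODE.abs_speed_le {γ y : ℝ → ℝ} (hγ : IsControl γ) (hy : SolvesODE γ y) {t : ℝ}
    (ht : t ∈ Icc (0 : ℝ) 2) : |speed γ y t| ≤ 3 := by
  rcases le_total t 1 with h | h
  · have e : drift t + 2 * x₁ t = 2 * (t - 1) := by unfold drift x₁; ring
    rw [hy.speed_of_le h, e, abs_le]
    constructor <;> linarith [ht.1]
  · have ht' : t ∈ Icc (1 : ℝ) 2 := ⟨h, ht.2⟩
    rw [abs_of_nonneg (hy.speed_nonneg hγ ht'), speed_of_ge h]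
    have h1 : γ t * y t ≤ 1 :=
      mul_le_one₀ (hγ.2 t ht').2 (hy.nonneg hγ t ht') (hy.le_one hγ ht')
    have h2 : drift t ≤ 1 := by unfold drift; nlinarith [sq_nonneg (t - 3 / 2)]
    linarith

theorem SolvesODE.integrableOn_speed {γ y : ℝ → ℝ} (hγ : IsControl γ) (hy : SolvesODE γ y) :
    IntegrableOn (speed γ y) (Icc 0 2) := by
  rw [← Icc_union_Icc_eq_Icc zero_le_one one_le_two]
  refine IntegrableOn.union ?_ ?_
  · rw [integrableOn_congr_fun (fun t ht => hy.speed_of_le ht.2) measurableSet_Icc]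
    refine Continuous.integrableOn_Icc ?_
    unfold drift x₁
    fun_prop
  · rw [integrableOn_congr_fun (fun t ht => speed_of_ge ht.1) measurableSet_Icc]
    exact hγ.integrableOn_rhs hy.1

theorem front_of_le (y : ℝ → ℝ) {t : ℝ} (ht : t ≤ 1) : front y t = x₁ t := if_pos ht

theorem SolvesODE.front_of_ge {γ y : ℝ → ℝ} (hy : SolvesODE γ y) {t : ℝ} (ht : 1 ≤ t) :
    front y t = y t := by
  rcases ht.eq_or_lt with rfl | h
  · rw [front_of_le y le_rfl, hy.one_eq_zero]
    simp [x₁]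
  · exact if_neg (not_le.2 h)

theorem SolvesODE.front_nonneg {γ y : ℝ → ℝ} (hγ : IsControl γ) (hy : SolvesODE γ y) {t : ℝ}
    (ht : t ≤ 2) : 0 ≤ front y t := by
  rcases le_total t 1 with h | h
  · rw [front_of_le y h]
    exact x₁_nonneg t
  · rw [hy.front_of_ge h]
    exact hy.nonneg hγ t ⟨h, ht⟩

theorem SolvesODE.plateau_le_front {γ y : ℝ → ℝ} (hγ : IsControl γ) (hy : SolvesODE γ y) {t : ℝ}
    (ht : t ≤ 2) : plateau t ≤ front y t := by
  unfold plateau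
  split_ifs with h
  · rw [front_of_le y h]
  · exact hy.front_nonneg hγ ht

theorem SolvesODE.front_sub_eq {γ y : ℝ → ℝ} (hγ : IsControl γ) (hy : SolvesODE γ y) {s t : ℝ}
    (hs : s ∈ Icc (0 : ℝ) 2) (ht : t ∈ Icc (0 : ℝ) 2) :
    front y t - front y s = ∫ τ in s..t, speed γ y τ := by
  have h1 : (1 : ℝ) ∈ Icc (0 : ℝ) 2 := ⟨zero_le_one, one_le_two⟩
  have hi := hy.integrableOn_speed hγ
  have key : ∀ t ∈ Icc (0 : ℝ) 2, front y t - front y 1 = ∫ τ in (1 : ℝ)..t, speed γ y τ := by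
    intro t ht
    rcases le_total t 1 with h | h
    · rw [front_of_le y h, front_of_le y le_rfl, x₁_sub_eq]
      refine intervalIntegral.integral_congr fun τ hτ => ?_
      rw [uIcc_of_ge h] at hτ
      exact (hy.speed_of_le hτ.2).symm
    · rw [hy.front_of_ge h, hy.front_of_ge le_rfl, hy.sub_eq hγ one_mem ⟨h, ht.2⟩]
      refine intervalIntegral.integral_congr fun τ hτ => ?_
      rw [uIcc_of_le h] at hτ
      exact (speed_of_ge hτ.1).symm
  rw [← intervalIntegral.integral_interval_sub_left
    (intervalIntegrable_of_integrableOn_Icc hi h1 ht)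
    (intervalIntegrable_of_integrableOn_Icc hi h1 hs), ← key t ht, ← key s hs]
  ring

theorem SolvesODE.abs_front_sub_le {γ y : ℝ → ℝ} (hγ : IsControl γ) (hy : SolvesODE γ y) {s t : ℝ}
    (hs : s ∈ Icc (0 : ℝ) 2) (ht : t ∈ Icc (0 : ℝ) 2) :
    |front y t - front y s| ≤ 3 * |t - s| := by
  rw [hy.front_sub_eq hγ hs ht]
  exact intervalIntegral.norm_integral_le_of_norm_le_const (f := speed γ y) fun τ hτ =>
    hy.abs_speed_le hγ (uIcc_subset_Icc hs ht (uIoc_subset_uIcc hτ))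

theorem plateau_eq (t : ℝ) : plateau t = x₁ (min t 1) := by
  unfold plateau
  split_ifs with h
  · rw [min_eq_left h]
  · rw [min_eq_right (not_le.1 h).le]
    simp [x₁]

theorem abs_plateau_sub_le {s t : ℝ} (hs : s ∈ Icc (0 : ℝ) 2) (ht : t ∈ Icc (0 : ℝ) 2) :
    |plateau t - plateau s| ≤ 2 * |t - s| := by
  rw [plateau_eq, plateau_eq]
  have h : |min t 1 - min s 1| ≤ |t - s| := by
    simpa using abs_min_sub_min_le_max t 1 s 1
  have e : x₁ (min t 1) - x₁ (min s 1) = (min t 1 + min s 1 - 2) * (min t 1 - min s 1) := by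
    unfold x₁; ring
  rw [e, abs_mul]
  have h2 : |min t 1 + min s 1 - 2| ≤ 2 := by
    have a1 := le_min ht.1 (zero_le_one (α := ℝ))
    have a2 := le_min hs.1 (zero_le_one (α := ℝ))
    rw [abs_le]
    constructor <;> linarith [min_le_right t 1, min_le_right s 1]
  exact mul_le_mul h2 h (abs_nonneg _) zero_le_two

/-- The constant is `3` in time, from the bound on `speed`, plus `1` in space. -/
theorem SolvesODE.lipschitzOnWith_profile {γ y : ℝ → ℝ} (hγ : IsControl γ) (hy : SolvesODE γ y) :
    LipschitzOnWith 4 (Function.uncurry (profile y)) (univ ×ˢ Icc 0 2) := by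
  refine LipschitzOnWith.of_dist_le_mul ?_
  rintro ⟨x, t⟩ ⟨-, ht⟩ ⟨x', s⟩ ⟨-, hs⟩
  simp only at ht hs
  have h1 := abs_plateau_sub_le hs ht
  have h2 := hy.abs_front_sub_le hγ hs ht
  have h3 : |t - s| ≤ dist (x, t) (x', s) := by
    rw [← Real.dist_eq]; exact le_max_right _ _
  have h4 : |x - x'| ≤ dist (x, t) (x', s) := by
    rw [← Real.dist_eq]; exact le_max_left _ _
  have h5 : |(front y t - |x|) - (front y s - |x'|)| ≤ |front y t - front y s| + |x - x'| := by
    have e : (front y t - |x|) - (front y s - |x'|) = (front y t - front y s) - (|x| - |x'|) := by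
      ring
    rw [e]
    exact (abs_sub _ _).trans (add_le_add_right (abs_abs_sub_abs_le_abs_sub x x') _)
  simp only [Function.uncurry, profile]
  rw [Real.dist_eq]
  refine (abs_min_sub_min_le_max _ _ _ _).trans (max_le ?_ ?_)
  · have := abs_nonneg (t - s)
    norm_num
    linarith
  · norm_num
    linarith

theorem SolvesODE.continuousAt_profile {γ y : ℝ → ℝ} (hγ : IsControl γ) (hy : SolvesODE γ y)
    (x₀ : ℝ) {t₀ : ℝ} (ht₀ : t₀ ∈ Ioo (0 : ℝ) 2) :
    ContinuousAt (fun z : ℝ × ℝ => profile y z.1 z.2) (x₀, t₀) :=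
  (hy.lipschitzOnWith_profile hγ).continuousOn.continuousAt
    (mem_of_superset (eventually_mem_strip ht₀) (prod_mono_right Ioo_subset_Icc_self))

theorem SolvesODE.continuousAt_front {γ y : ℝ → ℝ} (hγ : IsControl γ) (hy : SolvesODE γ y)
    {t₀ : ℝ} (ht₀ : t₀ ∈ Ioo (0 : ℝ) 2) : ContinuousAt (front y) t₀ := by
  have h : LipschitzOnWith 3 (front y) (Icc 0 2) :=
    LipschitzOnWith.of_dist_le_mul fun t ht s hs => hy.abs_front_sub_le hγ hs ht
  exact h.continuousOn.continuousAt (Icc_mem_nhds ht₀.1 ht₀.2)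

theorem continuous_plateau : Continuous plateau := by
  rw [funext plateau_eq]
  unfold x₁
  fun_prop

/-! ## The viscosity property of the explicit solution -/

/-- `σ` is an outward radial direction, so that one computation serves both half-lines and the
origin. -/
theorem exists_sign (x : ℝ) : ∃ σ : ℝ, |σ| = 1 ∧ x = σ * |x| ∧
    ∀ h, -|x| ≤ h → |x + σ * h| = |x| + h := by
  rcases le_total 0 x with hx | hx
  · refine ⟨1, by simp, by rw [abs_of_nonneg hx, one_mul], fun h hh => ?_⟩
    rw [abs_of_nonneg hx] at hh ⊢
    rw [abs_of_nonneg (by linarith)]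
    ring
  · refine ⟨-1, by simp, by rw [abs_of_nonpos hx]; ring, fun h hh => ?_⟩
    rw [abs_of_nonpos hx] at hh ⊢
    rw [abs_of_nonpos (by linarith)]
    ring

theorem eventually_shift {P : ℝ → Prop} {x₀ : ℝ} (h : ∀ᶠ x in 𝓝 x₀, P x) (σ : ℝ) :
    ∀ᶠ s in 𝓝[>] (0 : ℝ), P (x₀ + σ * s) := by
  have : Tendsto (fun s : ℝ => x₀ + σ * s) (𝓝 0) (𝓝 x₀) := by
    have h : Tendsto (fun s : ℝ => x₀ + σ * s) (𝓝 0) (𝓝 (x₀ + σ * 0)) :=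
      Continuous.tendsto (by fun_prop) 0
    simpa using h
  exact nhdsWithin_le_nhds (this.eventually h)

theorem eventually_slice_left {P : ℝ × ℝ → Prop} {x₀ t₀ : ℝ} (h : ∀ᶠ z in 𝓝 (x₀, t₀), P z) :
    ∀ᶠ s in 𝓝[<] t₀, P (x₀, s) := by
  have : Tendsto (fun s : ℝ => (x₀, s)) (𝓝 t₀) (𝓝 (x₀, t₀)) :=
    Continuous.tendsto (by fun_prop) t₀
  exact nhdsWithin_le_nhds (this.eventually h)

theorem eventually_slice {P : ℝ × ℝ → Prop} {x₀ t₀ : ℝ} (h : ∀ᶠ z in 𝓝 (x₀, t₀), P z) :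
    ∀ᶠ x in 𝓝 x₀, P (x, t₀) := by
  have : Tendsto (fun x : ℝ => (x, t₀)) (𝓝 x₀) (𝓝 (x₀, t₀)) :=
    Continuous.tendsto (by fun_prop) x₀
  exact this.eventually h

/-- Touching a locally constant function forces slope zero, which multiplies the velocity away;
hence `c` is arbitrary and `C = 0` suffices. -/
theorem solutionAt_of_flat {c v : ℝ → ℝ → ℝ} {x₀ t₀ : ℝ} (ht₀ : t₀ ∈ Ioo (0 : ℝ) 2)
    (hv : ∀ᶠ z : ℝ × ℝ in 𝓝 (x₀, t₀), v z.1 z.2 = v x₀ t₀) :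
    SubsolutionAt c v x₀ t₀ ∧ SupersolutionAt c v x₀ t₀ := by
  have hs := eventually_slice hv
  have ht := eventually_slice_left hv
  constructor
  · refine subsolutionAt_of_curve (C := 0) ht₀ (integrable_zero _ _ _) fun f p hf hle => ?_
    have hp : p = 0 := IsLocalMin.hasDerivAt_eq_zero (f := f) (by
      filter_upwards [hle, hs] with x h1 h2
      linarith) hf
    refine ⟨by simp [hp], fun _ => x₀, 0, by simp, ?_⟩
    filter_upwards [ht] with s h
    simp [h]
  · refine supersolutionAt_of_curve (C := 0) ht₀ (integrable_zero _ _ _) fun f p hf hle => ?_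
    have hp : p = 0 := IsLocalMax.hasDerivAt_eq_zero (f := f) (by
      filter_upwards [hle, hs] with x h1 h2
      linarith) hf
    refine ⟨by simp [hp], fun _ => x₀, 0, by simp, ?_⟩
    filter_upwards [ht] with s h
    simp [h]

section
variable {γ y : ℝ → ℝ} {c : ℝ → ℝ → ℝ} {x₀ t₀ : ℝ}

theorem SolvesODE.integrableOn_speed_Ioo (hγ : IsControl γ) (hy : SolvesODE γ y) :
    IntegrableOn (speed γ y) (Ioo 0 2) :=
  (hy.integrableOn_speed hγ).mono_set Ioo_subset_Icc_self

theorem eventually_left_mem {t₀ a : ℝ} (h : a < t₀) : ∀ᶠ s in 𝓝[<] t₀, a < s ∧ s < t₀ :=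
  Eventually.and (nhdsWithin_le_nhds (lt_mem_nhds h)) self_mem_nhdsWithin

/-- Outside the front the solution is `front - |x|`. -/
theorem SolvesODE.solutionAt_of_gt (hγ : IsControl γ) (hy : SolvesODE γ y)
    (ht₀ : t₀ ∈ Ioo (0 : ℝ) 2)
    (hc : ∀ᵐ t ∂(volume.restrict (Ioo (0 : ℝ) 2)), c x₀ t = speed γ y t)
    (hx : front y t₀ - |x₀| < plateau t₀) :
    SubsolutionAt c (profile y) x₀ t₀ ∧ SupersolutionAt c (profile y) x₀ t₀ := by
  have hev : ∀ᶠ z : ℝ × ℝ in 𝓝 (x₀, t₀), profile y z.1 z.2 = front y z.2 - |z.1| := by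
    have h1 : ContinuousAt (fun z : ℝ × ℝ => front y z.2 - |z.1|) (x₀, t₀) :=
      (ContinuousAt.comp (g := front y) (hy.continuousAt_front hγ ht₀) continuousAt_snd).sub
        continuousAt_fst.abs
    have h2 : ContinuousAt (fun z : ℝ × ℝ => plateau z.2) (x₀, t₀) :=
      (continuous_plateau.comp continuous_snd).continuousAt
    filter_upwards [h1.eventually_lt h2 hx] with z hz
    exact min_eq_right hz.le
  have h0 : profile y x₀ t₀ = front y t₀ - |x₀| := hev.self_of_nhds
  have hs := eventually_slice hev
  have ht := eventually_slice_left hev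
  have hx0 : 0 < |x₀| := by linarith [hy.plateau_le_front hγ ht₀.2.le]
  obtain ⟨σ, hσ, -, hσx⟩ := exists_sign x₀
  have hright : ∀ᶠ h in 𝓝[>] (0 : ℝ), profile y (x₀ + σ * h) t₀ - profile y x₀ t₀ = -h := by
    filter_upwards [eventually_shift hs σ, self_mem_nhdsWithin] with h h1 h2
    rw [h1, h0, hσx h (by linarith [mem_Ioi.1 h2])]
    ring
  have hleft : ∀ᶠ h in 𝓝[>] (0 : ℝ), profile y (x₀ + (-σ) * h) t₀ - profile y x₀ t₀ = h := by
    filter_upwards [eventually_shift hs (-σ), nhdsWithin_le_nhds (gt_mem_nhds hx0)] with h h1 h2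
    rw [h1, h0, neg_mul, ← mul_neg, hσx (-h) (by linarith)]
    ring
  have hcp : ∀ p : ℝ, ∀ᵐ t ∂(volume.restrict (Ioo (0 : ℝ) 2)),
      c x₀ t * |p| = speed γ y t * |p| := fun p => hc.mono fun t h => by rw [h]
  have hvert : ∀ᶠ s in 𝓝[<] t₀,
      profile y x₀ t₀ - profile y x₀ s = ∫ τ in s..t₀, speed γ y τ := by
    filter_upwards [ht, eventually_left_mem ht₀.1] with s h1 h2
    rw [h1, h0, ← hy.front_sub_eq hγ ⟨h2.1.le, (h2.2.trans ht₀.2).le⟩ (Ioo_subset_Icc_self ht₀)]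
    ring
  have habs : ∀ p : ℝ, σ * p = -1 → |p| = 1 := by
    intro p hp
    have := abs_mul σ p
    rw [hp, hσ] at this
    simpa using this.symm
  constructor
  · refine subsolutionAt_of_curve ht₀ (hy.integrableOn_speed_Ioo hγ) fun f p hf hle =>
      ⟨hcp p, fun _ => x₀, 0, by simp, ?_⟩
    -- Comparison in the outward and inward directions pins the radial slope to `-1`.
    have h1 : -1 ≤ σ * p := le_mul_deriv hf (by
      filter_upwards [eventually_shift hle σ, hright] with h a b
      linarith)
    have h2 : 1 ≤ -σ * p := le_mul_deriv hf (by
      filter_upwards [eventually_shift hle (-σ), hleft] with h a b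
      linarith)
    rw [habs p (by linarith)]
    filter_upwards [hvert] with s hs
    rw [← hs]
    simp
  · refine supersolutionAt_of_curve ht₀ (hy.integrableOn_speed_Ioo hγ) fun f p hf hle =>
      ⟨hcp p, fun _ => x₀, 0, by simp, ?_⟩
    have h1 : σ * p ≤ -1 := mul_deriv_le hf (by
      filter_upwards [eventually_shift hle σ, hright] with h a b
      linarith)
    have h2 : -σ * p ≤ 1 := mul_deriv_le hf (by
      filter_upwards [eventually_shift hle (-σ), hleft] with h a b
      linarith)
    rw [habs p (by linarith)]
    filter_upwards [hvert] with s hs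
    rw [← hs]
    simp

/-- Inside the front the solution vanishes. -/
theorem SolvesODE.solutionAt_of_lt (hγ : IsControl γ) (hy : SolvesODE γ y)
    (ht₀ : t₀ ∈ Ioo (0 : ℝ) 2) (hx : plateau t₀ < front y t₀ - |x₀|) :
    SubsolutionAt c (profile y) x₀ t₀ ∧ SupersolutionAt c (profile y) x₀ t₀ := by
  have h1t : 1 < t₀ := by
    by_contra! h
    rw [front_of_le y h, plateau, if_pos h] at hx
    linarith [abs_nonneg x₀]
  have hev : ∀ᶠ z : ℝ × ℝ in 𝓝 (x₀, t₀), profile y z.1 z.2 = 0 := by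
    have h1 : ContinuousAt (fun z : ℝ × ℝ => front y z.2 - |z.1|) (x₀, t₀) :=
      (ContinuousAt.comp (g := front y) (hy.continuousAt_front hγ ht₀) continuousAt_snd).sub
        continuousAt_fst.abs
    have h2 : ContinuousAt (fun z : ℝ × ℝ => plateau z.2) (x₀, t₀) :=
      (continuous_plateau.comp continuous_snd).continuousAt
    have h3 : ∀ᶠ z : ℝ × ℝ in 𝓝 (x₀, t₀), 1 < z.2 :=
      continuousAt_snd.eventually (lt_mem_nhds h1t)
    filter_upwards [h2.eventually_lt h1 hx, h3] with z hz h3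
    rw [profile, min_eq_left hz.le, plateau, if_neg (not_le.2 h3)]
  refine solutionAt_of_flat ht₀ ?_
  rw [show profile y x₀ t₀ = 0 from hev.self_of_nhds]
  exact hev

theorem SolvesODE.subsolutionAt_of_eq (hγ : IsControl γ) (hy : SolvesODE γ y)
    (ht₀ : t₀ ∈ Ioo (0 : ℝ) 2)
    (hc : ∀ᵐ t ∂(volume.restrict (Ioo (0 : ℝ) 2)), c x₀ t = speed γ y t)
    (hx : front y t₀ - |x₀| = plateau t₀) : SubsolutionAt c (profile y) x₀ t₀ := by
  refine subsolutionAt_of_curve ht₀ (hy.integrableOn_speed_Ioo hγ) fun f p hf hle =>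
      ⟨hc.mono fun t h => by rw [h], ?_⟩
  rcases le_or_gt t₀ 1 with h1 | h1
  · rw [front_of_le y h1, plateau, if_pos h1] at hx
    have hx0 : x₀ = 0 := abs_eq_zero.1 (by linarith)
    subst hx0
    have hp : ∀ σ : ℝ, |σ| = 1 → -1 ≤ σ * p := fun σ hσ => le_mul_deriv hf (by
      filter_upwards [eventually_shift hle σ, self_mem_nhdsWithin] with h a b
      rw [profile_of_le h1, profile_of_le h1, zero_add, abs_mul, hσ, abs_of_pos b] at a
      rw [zero_add]
      simp only [abs_zero] at a
      linarith)
    have hp1 := hp 1 (by simp)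
    have hp2 := hp (-1) (by simp)
    have hp3 : |p| ≤ 1 := abs_le.2 ⟨by linarith, by linarith⟩
    refine ⟨fun _ => 0, 0, by simp, ?_⟩
    filter_upwards [eventually_left_mem ht₀.1] with s hs
    rw [← hy.front_sub_eq hγ ⟨hs.1.le, (hs.2.trans ht₀.2).le⟩ (Ioo_subset_Icc_self ht₀),
      profile_of_le h1, profile_of_le (hs.2.le.trans h1), front_of_le y h1,
      front_of_le y (hs.2.le.trans h1)]
    -- The tip of the cone sinks, so replacing slope `1` by `|p| ≤ 1` increases the right-hand side.
    have h4 : x₁ t₀ - x₁ s ≤ 0 := by unfold x₁; nlinarith [hs.1, hs.2]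
    simp only [abs_zero, sub_zero, mul_zero]
    nlinarith
  · rw [plateau, if_neg (not_le.2 h1), sub_eq_zero] at hx
    obtain ⟨σ, hσ, hσx, -⟩ := exists_sign x₀
    -- Along the front the solution stays zero, so only the term in `p` remains; it is controlled
    -- because the front advances. The `3` bounds its speed.
    refine ⟨fun s => σ * front y s, 3, ?_, ?_⟩
    · filter_upwards [eventually_left_mem ht₀.1] with s hs
      rw [hσx, ← hx, ← mul_sub, abs_mul, hσ, one_mul]
      refine (hy.abs_front_sub_le hγ (Ioo_subset_Icc_self ht₀)
        ⟨hs.1.le, (hs.2.trans ht₀.2).le⟩).trans_eq ?_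
      rw [abs_sub_comm, abs_of_nonneg (by linarith [hs.2])]
    · filter_upwards [eventually_left_mem h1] with s hs
      have hs2 : s ≤ 2 := (hs.2.trans ht₀.2).le
      have hf := hy.front_sub_eq hγ ⟨by linarith [hs.1], hs2⟩ (Ioo_subset_Icc_self ht₀)
      have hmono := hy.monotoneOn hγ ⟨hs.1.le, hs2⟩ ⟨h1.le, ht₀.2.le⟩ hs.2.le
      rw [← hy.front_of_ge hs.1.le, ← hy.front_of_ge h1.le] at hmono
      rw [← hf, hy.profile_of_ge h1.le, hy.profile_of_ge hs.1.le, ← hy.front_of_ge h1.le,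
        ← hy.front_of_ge hs.1.le, hx, abs_mul, hσ, one_mul,
        abs_of_nonneg (hy.front_nonneg hγ hs2), sub_self, sub_self, min_self, sub_self, zero_sub]
      rw [hx] at hmono
      nth_rewrite 1 [hσx]
      rw [← mul_sub, ← mul_assoc, ← neg_mul]
      refine mul_le_mul_of_nonneg_right ?_ (by linarith)
      have := neg_le_abs (p * σ)
      rwa [abs_mul, hσ, mul_one] at this

/-- No smooth function touches a concave kink from below: the outward radial slope would be both at
most `-1` and at least `0`. -/
theorem SolvesODE.supersolutionAt_of_eq (hγ : IsControl γ) (hy : SolvesODE γ y)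
    (ht₀ : t₀ ∈ Ioo (0 : ℝ) 2)
    (hx : front y t₀ - |x₀| = plateau t₀) : SupersolutionAt c (profile y) x₀ t₀ := by
  refine supersolutionAt_of_curve ht₀ (hy.integrableOn_speed_Ioo hγ) fun f p hf hle => ?_
  exfalso
  obtain ⟨σ, -, -, hσx⟩ := exists_sign x₀
  have h0 : profile y x₀ t₀ = plateau t₀ := by rw [profile, hx, min_self]
  have h1 : σ * p ≤ -1 := mul_deriv_le hf (by
    filter_upwards [eventually_shift hle σ, self_mem_nhdsWithin] with h a b
    have : profile y (x₀ + σ * h) t₀ ≤ front y t₀ - |x₀ + σ * h| := min_le_right _ _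
    rw [hσx h (by linarith [mem_Ioi.1 b, abs_nonneg x₀])] at this
    linarith)
  have h2 : -σ * p ≤ 0 := mul_deriv_le hf (by
    filter_upwards [eventually_shift hle (-σ)] with h a
    have : profile y (x₀ + -σ * h) t₀ ≤ plateau t₀ := min_le_left _ _
    linarith)
  linarith

theorem SolvesODE.solutionAt_profile (hγ : IsControl γ) (hy : SolvesODE γ y)
    (ht₀ : t₀ ∈ Ioo (0 : ℝ) 2)
    (hc : ∀ᵐ t ∂(volume.restrict (Ioo (0 : ℝ) 2)), c x₀ t = speed γ y t) :
    SubsolutionAt c (profile y) x₀ t₀ ∧ SupersolutionAt c (profile y) x₀ t₀ := by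
  rcases lt_trichotomy (front y t₀ - |x₀|) (plateau t₀) with h | h | h
  · exact hy.solutionAt_of_gt hγ ht₀ hc h
  · exact ⟨hy.subsolutionAt_of_eq hγ ht₀ hc h, hy.supersolutionAt_of_eq hγ ht₀ h⟩
  · exact hy.solutionAt_of_lt hγ ht₀ h

/-- The truncation of the solution at the level `-1`. -/
noncomputable def truncatedProfile (y : ℝ → ℝ) (x t : ℝ) : ℝ := max (profile y x t) (-1)

/-- The kink at level `-1` is convex, so nothing smooth touches from above. From below, the curve
follows the level line `|x| = 1 + front`, and the inequality is an equality whatever the sign of the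
speed. -/
theorem SolvesODE.solutionAt_truncatedProfile_of_eq (hγ : IsControl γ) (hy : SolvesODE γ y)
    (ht₀ : t₀ ∈ Ioo (0 : ℝ) 2)
    (hc : ∀ᵐ t ∂(volume.restrict (Ioo (0 : ℝ) 2)), c x₀ t = speed γ y t)
    (hx : profile y x₀ t₀ = -1) :
    SubsolutionAt c (truncatedProfile y) x₀ t₀ ∧ SupersolutionAt c (truncatedProfile y) x₀ t₀ := by
  have hpl := plateau_nonneg t₀
  have hx1 : |x₀| = 1 + front y t₀ := by
    rw [profile] at hx
    rcases min_choice (plateau t₀) (front y t₀ - |x₀|) with h | h <;> linarith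
  have hfr := hy.front_nonneg hγ ht₀.2.le
  have h0 : truncatedProfile y x₀ t₀ = -1 := by rw [truncatedProfile, hx, max_self]
  obtain ⟨σ, hσ, hσx, hσh⟩ := exists_sign x₀
  constructor
  · refine subsolutionAt_of_curve ht₀ (hy.integrableOn_speed_Ioo hγ) fun f p hf hle => ?_
    exfalso
    have h1 : 0 ≤ σ * p := le_mul_deriv hf (by
      filter_upwards [eventually_shift hle σ] with h a
      have : -1 ≤ truncatedProfile y (x₀ + σ * h) t₀ := le_max_right _ _
      linarith)
    have h2 : 1 ≤ -σ * p := le_mul_deriv hf (by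
      filter_upwards [eventually_shift hle (-σ), nhdsWithin_le_nhds (gt_mem_nhds one_pos)]
        with h a b
      have e : |x₀ + -σ * h| = |x₀| - h := by
        rw [neg_mul, ← mul_neg, hσh (-h) (by linarith)]
        ring
      have : profile y (x₀ + -σ * h) t₀ ≤ truncatedProfile y (x₀ + -σ * h) t₀ := le_max_left _ _
      rw [profile, min_eq_right (by rw [e]; linarith), e] at this
      linarith)
    linarith
  · refine supersolutionAt_of_curve ht₀ (hy.integrableOn_speed_Ioo hγ) fun f p hf hle =>
      ⟨hc.mono fun t h => by rw [h], fun s => σ * (1 + front y s), 3, ?_, ?_⟩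
    · filter_upwards [eventually_left_mem ht₀.1] with s hs
      rw [hσx, hx1, ← mul_sub, abs_mul, hσ, one_mul, add_sub_add_left_eq_sub]
      refine (hy.abs_front_sub_le hγ (Ioo_subset_Icc_self ht₀)
        ⟨hs.1.le, (hs.2.trans ht₀.2).le⟩).trans_eq ?_
      rw [abs_sub_comm, abs_of_nonneg (by linarith [hs.2])]
    · have h1 : σ * p ≤ 0 := mul_deriv_le hf (by
        filter_upwards [eventually_shift hle σ, self_mem_nhdsWithin] with h a b
        have e : truncatedProfile y (x₀ + σ * h) t₀ ≤ -1 := by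
          refine max_le ((min_le_right _ _).trans ?_) le_rfl
          rw [hσh h (by linarith [mem_Ioi.1 b])]
          linarith [mem_Ioi.1 b]
        linarith)
      have hp : |p| = -(σ * p) := by
        rw [← abs_of_nonpos h1, abs_mul, hσ, one_mul]
      filter_upwards [eventually_left_mem ht₀.1] with s hs
      have hs2 : s ≤ 2 := (hs.2.trans ht₀.2).le
      have hfs := hy.front_nonneg hγ hs2
      have e : truncatedProfile y (σ * (1 + front y s)) s = -1 := by
        have e1 : |σ * (1 + front y s)| = 1 + front y s := by
          rw [abs_mul, hσ, one_mul, abs_of_nonneg (by linarith)]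
        rw [truncatedProfile, profile, e1, min_eq_right (by linarith [plateau_nonneg s])]
        simp
      rw [← hy.front_sub_eq hγ ⟨hs.1.le, hs2⟩ (Ioo_subset_Icc_self ht₀), h0, e, hp]
      have : x₀ = σ * (1 + front y t₀) := by rw [← hx1]; exact hσx
      rw [this]
      linarith

/-- The velocity matters only where the profile is at least `-1`, that is within `|x₀| ≤ 1 + front ≤
2`; beyond, the function is locally constant. -/
theorem SolvesODE.solutionAt_truncatedProfile (hγ : IsControl γ) (hy : SolvesODE γ y)
    (ht₀ : t₀ ∈ Ioo (0 : ℝ) 2)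
    (hc : |x₀| ≤ 2 → ∀ᵐ t ∂(volume.restrict (Ioo (0 : ℝ) 2)), c x₀ t = speed γ y t) :
    SubsolutionAt c (truncatedProfile y) x₀ t₀ ∧ SupersolutionAt c (truncatedProfile y) x₀ t₀ := by
  have hcont := hy.continuousAt_profile hγ x₀ ht₀
  have hfr : front y t₀ ≤ 1 := by
    rcases le_total t₀ 1 with h | h
    · rw [front_of_le y h]
      exact x₁_le_one (Ioo_subset_Icc_self ht₀)
    · rw [hy.front_of_ge h]
      exact hy.le_one hγ ⟨h, ht₀.2.le⟩
  have hle : -1 ≤ profile y x₀ t₀ → |x₀| ≤ 2 := fun h => by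
    have : profile y x₀ t₀ ≤ front y t₀ - |x₀| := min_le_right _ _
    linarith
  rcases lt_trichotomy (profile y x₀ t₀) (-1) with h | h | h
  · refine solutionAt_of_flat ht₀ ?_
    filter_upwards [hcont.eventually (gt_mem_nhds h)] with z hz
    rw [truncatedProfile, truncatedProfile, max_eq_right hz.le, max_eq_right h.le]
  · exact hy.solutionAt_truncatedProfile_of_eq hγ ht₀ (hc (hle h.ge)) h
  · have hev : ∀ᶠ z : ℝ × ℝ in 𝓝 (x₀, t₀), truncatedProfile y z.1 z.2 = profile y z.1 z.2 := by
      filter_upwards [hcont.eventually (lt_mem_nhds h)] with z hz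
      exact max_eq_left hz.le
    have := hy.solutionAt_profile hγ ht₀ (hc (hle h.le))
    exact ⟨this.1.congr hev, this.2.congr hev⟩

end

/-! ## Velocities generated by a time-independent kernel -/

section
variable {γ y k : ℝ → ℝ} {B : ℝ} {L : NNReal}

theorem chi_mem_Icc (hγ : IsControl γ) (x : ℝ) {t : ℝ} (ht : t ≤ 2) :
    chi γ y x t ∈ Icc (0 : ℝ) 1 := by
  unfold chi
  split_ifs with h
  · exact ⟨indicator_nonneg (fun _ _ => zero_le_one) x,
      indicator_le' (fun _ _ => le_rfl) (fun _ _ => zero_le_one) x⟩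
  · have hγt := hγ.2 t ⟨not_lt.1 h, ht⟩
    exact ⟨indicator_nonneg (fun _ _ => hγt.1) x,
      indicator_le' (fun _ _ => hγt.2) (fun _ _ => zero_le_one) x⟩

theorem SolvesODE.integral_chi_le (hγ : IsControl γ) (hy : SolvesODE γ y) {t : ℝ}
    (ht : t ∈ Icc (0 : ℝ) 2) : ∫ x, chi γ y x t ≤ 2 := by
  rcases lt_or_ge t 1 with h | h
  · rw [integral_chi_of_lt γ y h]
    linarith [x₁_le_one ht]
  · have ht' : t ∈ Icc (1 : ℝ) 2 := ⟨h, ht.2⟩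
    rw [integral_chi_of_ge γ h (hy.nonneg hγ t ht')]
    have := mul_le_one₀ (hγ.2 t ht').2 (hy.nonneg hγ t ht') (hy.le_one hγ ht')
    linarith

theorem SolvesODE.abs_le_one_of_chi_ne_zero (hγ : IsControl γ) (hy : SolvesODE γ y) {x t : ℝ}
    (ht : t ∈ Icc (0 : ℝ) 2) (h : chi γ y x t ≠ 0) : |x| ≤ 1 := by
  unfold chi at h
  split_ifs at h with h1
  · exact (abs_le.2 (mem_Icc.1 (mem_of_indicator_ne_zero h))).trans (x₁_le_one ht)
  · exact (abs_le.2 (mem_Icc.1 (mem_of_indicator_ne_zero h))).trans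
      (hy.le_one hγ ⟨not_lt.1 h1, ht.2⟩)

theorem SolvesODE.velocity_eq_speed (hγ : IsControl γ) (hy : SolvesODE γ y) {x t : ℝ}
    (ht : t ∈ Icc (0 : ℝ) 2) (hk : ∀ z, |z| ≤ 1 → k (x - z) = 1) :
    velocity (fun x _ => k x) (fun _ => drift) (chi γ y) x t = speed γ y t := by
  have e : ∀ z, k (x - z) * chi γ y z t = chi γ y z t := by
    intro z
    by_cases h : chi γ y z t = 0
    · rw [h, mul_zero]
    · rw [hk z (hy.abs_le_one_of_chi_ne_zero hγ ht h), one_mul]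
  unfold velocity
  simp_rw [e]
  rcases lt_or_ge t 1 with h | h
  · rw [integral_chi_of_lt γ y h, speed, if_pos h, add_comm]
  · rw [integral_chi_of_ge γ h (hy.nonneg hγ t ⟨h, ht.2⟩), speed_of_ge h, add_comm]

theorem volume_restrict_strip :
    (volume : Measure (ℝ × ℝ)).restrict (univ ×ˢ Ioo 0 2) =
      (volume : Measure ℝ).prod (volume.restrict (Ioo 0 2)) := by
  rw [Measure.volume_eq_prod, ← Measure.prod_restrict, Measure.restrict_univ]

theorem SolvesODE.aemeasurable_chi (hγ : IsControl γ) (hy : SolvesODE γ y) :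
    AEMeasurable (Function.uncurry (chi γ y)) (volume.restrict ((univ : Set ℝ) ×ˢ Ioo 0 2)) := by
  obtain ⟨v, hv, hvy⟩ := exists_continuous_extension hy.1
  obtain ⟨g, hg, hγg⟩ := hγ.1
  have hx : Continuous x₁ := by unfold x₁; fun_prop
  refine ⟨fun z => if z.2 < 1 then (if |z.1| ≤ x₁ z.2 then 1 else 0)
    else (if |z.1| ≤ v z.2 then g z.2 else 0), ?_, ?_⟩
  · refine Measurable.ite (measurableSet_lt measurable_snd measurable_const)
      (Measurable.ite (measurableSet_le measurable_fst.abs (hx.measurable.comp measurable_snd))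
        measurable_const measurable_const)
      (Measurable.ite (measurableSet_le measurable_fst.abs (hv.measurable.comp measurable_snd))
        (hg.comp measurable_snd) measurable_const)
  · have h1 : ∀ᵐ t ∂(volume.restrict (Ioo (0 : ℝ) 2)), 1 ≤ t → γ t = g t := by
      have := (ae_restrict_iff' measurableSet_Icc).1 hγg
      filter_upwards [ae_restrict_of_ae this, ae_restrict_mem measurableSet_Ioo] with t h ht h1
      exact h ⟨h1, ht.2.le⟩
    have h2 : ∀ᵐ z ∂(volume.restrict ((univ : Set ℝ) ×ˢ Ioo (0 : ℝ) 2)),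
        1 ≤ z.2 → γ z.2 = g z.2 := by
      rw [volume_restrict_strip]
      -- A null set of times pulls back to a null set of the strip.
      exact Measure.quasiMeasurePreserving_snd.ae h1
    filter_upwards [h2, ae_restrict_mem (MeasurableSet.univ.prod measurableSet_Ioo)] with z hz hzs
    simp only [Function.uncurry, chi]
    by_cases h : z.2 < 1
    · simp only [if_pos h, indicator_apply, mem_Icc, abs_le]
    · rw [← hvy ⟨not_lt.1 h, hzs.2.2.le⟩, hz (not_lt.1 h)]
      simp only [if_neg h, indicator_apply, mem_Icc, abs_le]

theorem integrable_kernel_mul_chi (hk : Continuous k) (hB : ∀ x, |k x| ≤ B) (x t : ℝ) :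
    Integrable fun z => k (x - z) * chi γ y z t :=
  (integrable_chi γ y t).bdd_mul (c := B) (by fun_prop)
    (Eventually.of_forall fun z => hB (x - z))

/-- Convolution with `chi`, of mass at most `2`, at most doubles the bound and the Lipschitz
constant of the kernel; `4` bounds the drift on the time interval. -/
theorem SolvesODE.isAdmissibleVelocity (hγ : IsControl γ) (hy : SolvesODE γ y)
    (hB : ∀ x, |k x| ≤ B) (hL : LipschitzWith L k) :
    IsAdmissibleVelocity 2 (velocity (fun x _ => k x) (fun _ => drift) (chi γ y)) := by
  have hint := integrable_kernel_mul_chi (γ := γ) (y := y) hL.continuous hB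
  have hbound : ∀ (f : ℝ → ℝ) (t M : ℝ), t ∈ Icc (0 : ℝ) 2 → 0 ≤ M → (∀ z, |f z| ≤ M) →
      |∫ z, f z * chi γ y z t| ≤ M * 2 := by
    intro f t M ht hM hf
    refine (norm_integral_le_of_norm_le (f := fun z => f z * chi γ y z t)
      ((integrable_chi γ y t).const_mul M)
      (Eventually.of_forall fun z => ?_)).trans ?_
    · have hc := (chi_mem_Icc (y := y) hγ z ht.2).1
      rw [Real.norm_eq_abs, abs_mul, abs_of_nonneg hc]
      exact mul_le_mul_of_nonneg_right (hf z) hc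
    · rw [integral_const_mul]
      exact mul_le_mul_of_nonneg_left (hy.integral_chi_le hγ ht) hM
  have hB0 : 0 ≤ B := (abs_nonneg _).trans (hB 0)
  refine ⟨fun x => ?_, B * 2 + 4, L * 2, ?_⟩
  · refine AEMeasurable.add ?_ continuous_drift.aemeasurable
    have hm : AEStronglyMeasurable (fun z : ℝ × ℝ => k (x - z.1) * Function.uncurry (chi γ y) z)
        ((volume : Measure ℝ).prod (volume.restrict (Ioo 0 2))) := by
      rw [← volume_restrict_strip]
      have hkm : Continuous fun z : ℝ × ℝ => k (x - z.1) :=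
        hL.continuous.comp (by fun_prop)
      exact hkm.aestronglyMeasurable.mul (hy.aemeasurable_chi hγ).aestronglyMeasurable
    exact hm.prod_swap.integral_prod_right'.aemeasurable
  · filter_upwards [ae_restrict_mem measurableSet_Ioo] with t ht x x'
    have ht' := Ioo_subset_Icc_self ht
    unfold velocity
    constructor
    · have hd : |drift t| ≤ 4 := by
        unfold drift
        rw [abs_le]
        constructor <;> nlinarith [ht.1, ht.2]
      exact (abs_add_le _ _).trans (add_le_add (hbound _ t B ht' hB0 fun z => hB (x - z)) hd)
    · rw [add_sub_add_right_eq_sub, ← integral_sub (hint x t) (hint x' t)]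
      simp_rw [← sub_mul]
      refine (hbound _ t (L * |x - x'|) ht' (by positivity) fun z => ?_).trans_eq (by ring)
      have := hL.dist_le_mul (x - z) (x' - z)
      rwa [Real.dist_eq, Real.dist_eq, sub_sub_sub_cancel_right] at this

/-! ## Weak solutions -/

theorem isL1ViscositySolution_of_solutionAt {c u v : ℝ → ℝ → ℝ} {u₀ : ℝ → ℝ}
    (hv : ContinuousOn (Function.uncurry v) (univ ×ˢ Icc 0 2))
    (huv : ∀ x, ∀ t ∈ Icc (0 : ℝ) 2, u x t = v x t) (h0 : ∀ x, v x 0 = u₀ x)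
    (h : ∀ x₀, ∀ t₀ ∈ Ioo (0 : ℝ) 2, SubsolutionAt c v x₀ t₀ ∧ SupersolutionAt c v x₀ t₀) :
    IsL1ViscositySolution 2 c u₀ u := by
  have hu : ContinuousOn (Function.uncurry u) (univ ×ˢ Icc 0 2) :=
    hv.congr fun z hz => huv z.1 z.2 hz.2
  have hu0 : ∀ x, u x 0 = u₀ x := fun x => (huv x 0 ⟨le_rfl, zero_le_two⟩).trans (h0 x)
  have hev : ∀ x₀, ∀ t₀ ∈ Ioo (0 : ℝ) 2,
      ∀ᶠ z : ℝ × ℝ in 𝓝 (x₀, t₀), u z.1 z.2 = v z.1 z.2 := fun x₀ t₀ ht₀ => by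
    filter_upwards [eventually_mem_strip ht₀] with z hz
    exact huv z.1 z.2 (Ioo_subset_Icc_self hz.2)
  exact ⟨⟨hu.upperSemicontinuousOn, fun x => (hu0 x).le, fun x₀ t₀ b φ G ht₀ =>
      (h x₀ t₀ ht₀).1.congr (hev x₀ t₀ ht₀) b φ G⟩,
    hu.lowerSemicontinuousOn, fun x => (hu0 x).ge, fun x₀ t₀ b φ G ht₀ =>
      (h x₀ t₀ ht₀).2.congr (hev x₀ t₀ ht₀) b φ G⟩

/-- The freedom in `γ` appears here: from time `1` on the positive set is empty, so the lower
constraint is just `0 ≤ γ`. -/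
theorem SolvesODE.chi_bounds (hγ : IsControl γ) (hy : SolvesODE γ y) (x : ℝ) {t : ℝ}
    (ht : t ∈ Icc (0 : ℝ) 2) :
    {x | 0 < profile y x t}.indicator (fun _ => (1 : ℝ)) x ≤ chi γ y x t ∧
      chi γ y x t ≤ {x | 0 ≤ profile y x t}.indicator (fun _ => (1 : ℝ)) x := by
  unfold chi
  split_ifs with h
  · rw [setOf_profile_pos_of_le h.le, setOf_profile_nonneg_of_le h.le]
    exact ⟨indicator_le_indicator_of_subset Ioo_subset_Icc_self (fun _ => zero_le_one) x, le_rfl⟩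
  · have h1 := not_lt.1 h
    have hγt := hγ.2 t ⟨h1, ht.2⟩
    rw [hy.setOf_profile_nonneg h1]
    have he : {x | 0 < profile y x t} = ∅ :=
      eq_empty_of_forall_notMem fun x hx => not_lt.2 (hy.profile_nonpos h1 x) hx
    rw [he, indicator_empty]
    exact ⟨indicator_nonneg (fun _ _ => hγt.1) x, indicator_le_indicator hγt.2⟩

/-- A function with the same sign as the explicit solution is a weak solution as soon as it has the
viscosity property. -/
theorem SolvesODE.isWeakSolutionWith (hγ : IsControl γ) (hy : SolvesODE γ y)
    (hB : ∀ x, |k x| ≤ B) (hL : LipschitzWith L k) {u v : ℝ → ℝ → ℝ} {u₀ : ℝ → ℝ} {K : NNReal}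
    (hv : LipschitzOnWith K (Function.uncurry v) (univ ×ˢ Icc 0 2))
    (huv : ∀ x, ∀ t ∈ Icc (0 : ℝ) 2, u x t = v x t) (h0 : ∀ x, v x 0 = u₀ x)
    (hpos : ∀ x t, 0 < v x t ↔ 0 < profile y x t)
    (hnonneg : ∀ x t, 0 ≤ v x t ↔ 0 ≤ profile y x t)
    (h : ∀ x₀, ∀ t₀ ∈ Ioo (0 : ℝ) 2,
      SubsolutionAt (velocity (fun x _ => k x) (fun _ => drift) (chi γ y)) v x₀ t₀ ∧
      SupersolutionAt (velocity (fun x _ => k x) (fun _ => drift) (chi γ y)) v x₀ t₀) :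
    IsWeakSolutionWith 2 (fun x _ => k x) (fun _ => drift) u₀ u (chi γ y) where
  lipschitz := ⟨K, fun z hz w hw => by
    have := hv hz hw
    simp only [Function.uncurry] at this ⊢
    rwa [huv z.1 z.2 hz.2, huv w.1 w.2 hw.2]⟩
  chi_measurable := hy.aemeasurable_chi hγ
  chi_mem x t ht := chi_mem_Icc hγ x ht.2.le
  chi_bounds := by
    filter_upwards [ae_restrict_mem (MeasurableSet.univ.prod measurableSet_Icc)] with z hz
    have e1 : {x | 0 < u x z.2} = {x | 0 < profile y x z.2} := by
      ext x
      simp only [mem_ofPred_eq, huv x z.2 hz.2, hpos]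
    have e2 : {x | 0 ≤ u x z.2} = {x | 0 ≤ profile y x z.2} := by
      ext x
      simp only [mem_ofPred_eq, huv x z.2 hz.2, hnonneg]
    rw [e1, e2]
    exact hy.chi_bounds hγ z.1 hz.2
  convolution_integrable :=
    Eventually.of_forall fun t x => integrable_kernel_mul_chi hL.continuous hB x t
  admissible := hy.isAdmissibleVelocity hγ hB hL
  solution := isL1ViscositySolution_of_solutionAt hv.continuousOn huv h0 h

theorem SolvesODE.ae_velocity_eq_speed (hγ : IsControl γ) (hy : SolvesODE γ y) {x : ℝ}
    (hk : ∀ z, |z| ≤ 1 → k (x - z) = 1) :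
    ∀ᵐ t ∂(volume.restrict (Ioo (0 : ℝ) 2)),
      velocity (fun x _ => k x) (fun _ => drift) (chi γ y) x t = speed γ y t := by
  filter_upwards [ae_restrict_mem measurableSet_Ioo] with t ht
  exact hy.velocity_eq_speed hγ (Ioo_subset_Icc_self ht) hk

theorem profile_zero (y : ℝ → ℝ) (x : ℝ) : profile y x 0 = datum x := by
  rw [profile_of_le zero_le_one]
  simp [x₁, datum]

theorem SolvesODE.isWeakSolutionWith_hopfLax (hγ : IsControl γ) (hy : SolvesODE γ y) :
    IsWeakSolutionWith 2 (fun _ _ => 1) (fun _ => drift) datum (hopfLax datum y) (chi γ y) :=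
  hy.isWeakSolutionWith (k := fun _ => 1) (B := 1) (L := 0) hγ (by simp) (LipschitzWith.const 1)
    (hy.lipschitzOnWith_profile hγ) (fun x _ ht => hopfLax_datum (hy.nonneg hγ) x ht)
    (profile_zero y) (fun _ _ => Iff.rfl) (fun _ _ => Iff.rfl)
    fun _ _ ht₀ => hy.solutionAt_profile hγ ht₀ (hy.ae_velocity_eq_speed hγ fun _ _ => rfl)

/-- The radius `3` is `2 + 1`: active points satisfy `|x₀| ≤ 2`, and `chi` is supported in `[-1,1]`.
-/
theorem SolvesODE.isWeakSolutionWith_truncated (hγ : IsControl γ) (hy : SolvesODE γ y)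
    (hB : ∀ x, |k x| ≤ B) (hL : LipschitzWith L k) (hk : ∀ x, |x| ≤ 3 → k x = 1) :
    IsWeakSolutionWith 2 (fun x _ => k x) (fun _ => drift) truncatedDatum
      (hopfLax truncatedDatum y) (chi γ y) := by
  refine hy.isWeakSolutionWith hγ hB hL (K := 4)
    (v := truncatedProfile y) ?_ (fun x _ ht => hopfLax_truncatedDatum (hy.nonneg hγ) x ht)
    (fun x => ?_) (fun x t => ?_) (fun x t => ?_)
    fun x₀ t₀ ht₀ => hy.solutionAt_truncatedProfile hγ ht₀ fun hx =>
      hy.ae_velocity_eq_speed hγ fun z hz => hk _ ?_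
  · refine LipschitzOnWith.of_dist_le_mul fun z hz w hw => ?_
    have h1 := (hy.lipschitzOnWith_profile hγ).dist_le_mul z hz w hw
    simp only [Function.uncurry, truncatedProfile]
    refine le_trans ?_ h1
    rw [Real.dist_eq, Real.dist_eq]
    simpa [Function.uncurry] using
      abs_max_sub_max_le_max (profile y z.1 z.2) (-1) (profile y w.1 w.2) (-1)
  · rw [truncatedProfile, profile_zero, truncatedDatum]
  · rw [truncatedProfile, lt_max_iff]
    exact or_iff_left (by norm_num)
  · rw [truncatedProfile, le_max_iff]
    exact or_iff_left (by norm_num)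
  · have := abs_sub x₀ z
    linarith

/-- The extreme controls are told apart at `x = 1`, `t = 2`, by values above `-1`, so the same point
works after truncation. -/
theorem profile_at_final_time_zero :
    profile (fun t => (t - 1) ^ 2 - 2 / 3 * (t - 1) ^ 3) 1 2 = -2 / 3 := by
  rw [solvesODE_zero.profile_of_ge one_le_two]
  norm_num

theorem profile_at_final_time_one : profile x₁ 1 2 = 0 := by
  rw [solvesODE_x₁.profile_of_ge one_le_two]
  norm_num [x₁]

end

theorem two_mem : (2 : ℝ) ∈ Icc (0 : ℝ) 2 := ⟨zero_le_two, le_rfl⟩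

theorem weakSolutionsNotUnique_datum :
    WeakSolutionsNotUnique 2 (fun _ _ => 1) (fun _ => drift) datum := by
  have h0 : IsControl fun _ => 0 := isControl_const (by simp)
  have h1 : IsControl fun _ => 1 := isControl_const (by simp)
  refine ⟨_, _, ⟨_, solvesODE_zero.isWeakSolutionWith_hopfLax h0⟩,
    ⟨_, solvesODE_x₁.isWeakSolutionWith_hopfLax h1⟩, 1, 2, two_mem, ?_⟩
  rw [hopfLax_datum (solvesODE_zero.nonneg h0) 1 two_mem,
    hopfLax_datum (solvesODE_x₁.nonneg h1) 1 two_mem, profile_at_final_time_zero,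
    profile_at_final_time_one]
  norm_num

theorem weakSolutionsNotUnique_truncatedDatum {k : ℝ → ℝ} {B : ℝ} {L : NNReal}
    (hB : ∀ x, |k x| ≤ B) (hL : LipschitzWith L k) (hk : ∀ x, |x| ≤ 3 → k x = 1) :
    WeakSolutionsNotUnique 2 (fun x _ => k x) (fun _ => drift) truncatedDatum := by
  have h0 : IsControl fun _ => 0 := isControl_const (by simp)
  have h1 : IsControl fun _ => 1 := isControl_const (by simp)
  refine ⟨_, _, ⟨_, solvesODE_zero.isWeakSolutionWith_truncated h0 hB hL hk⟩,
    ⟨_, solvesODE_x₁.isWeakSolutionWith_truncated h1 hB hL hk⟩, 1, 2, two_mem, ?_⟩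
  rw [hopfLax_truncatedDatum (solvesODE_zero.nonneg h0) 1 two_mem,
    hopfLax_truncatedDatum (solvesODE_x₁.nonneg h1) 1 two_mem, profile_at_final_time_zero,
    profile_at_final_time_one]
  norm_num

/-- The set where the solution is nonnegative reveals `y`, and `y` reveals `γ`. -/
theorem hopfLax_eq_iff {γ γ' y y' : ℝ → ℝ} (hγ : IsControl γ) (hγ' : IsControl γ')
    (hy : SolvesODE γ y) (hy' : SolvesODE γ' y') :
    (∀ x, ∀ t ∈ Icc (0 : ℝ) 2, hopfLax datum y x t = hopfLax datum y' x t) ↔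
      ∀ᵐ t ∂(volume.restrict (Icc (1 : ℝ) 2)), γ t = γ' t := by
  constructor
  · intro h
    refine hy.ae_eq_of_eqOn hγ hγ' hy' fun t ht => ?_
    have ht0 : t ∈ Icc (0 : ℝ) 2 := ⟨zero_le_one.trans ht.1, ht.2⟩
    have hset : {x | 0 ≤ profile y x t} = {x | 0 ≤ profile y' x t} := by
      ext x
      have := h x t ht0
      rw [hopfLax_datum (hy.nonneg hγ) x ht0, hopfLax_datum (hy'.nonneg hγ') x ht0] at this
      simp only [mem_ofPred_eq, this]
    rw [hy.setOf_profile_nonneg ht.1, hy'.setOf_profile_nonneg ht.1] at hset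
    have hyt := hy.nonneg hγ t ht
    have hyt' := hy'.nonneg hγ' t ht
    have h1 : y t ∈ Icc (-y' t) (y' t) := hset ▸ ⟨by linarith, le_rfl⟩
    have h2 : y' t ∈ Icc (-y t) (y t) := hset ▸ ⟨by linarith, le_rfl⟩
    exact le_antisymm h1.2 h2.2
  · intro h x t ht
    rw [hopfLax_datum (hy.nonneg hγ) x ht, hopfLax_datum (hy'.nonneg hγ') x ht]
    rcases le_total t 1 with h1 | h1
    · rw [profile_of_le h1, profile_of_le h1]
    · rw [hy.profile_of_ge h1, hy'.profile_of_ge h1, hy.eqOn_of_ae_eq hγ hγ' hy' h ⟨h1, ht.2⟩]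

/-! ## The assumptions of the general theory -/

theorem isAdmissibleDatum_truncatedDatum : IsAdmissibleDatum truncatedDatum := by
  refine ⟨fun x => ⟨le_max_right _ _, max_le ?_ (by norm_num)⟩, ⟨1, ?_⟩, 2, two_pos, fun x hx => ?_⟩
  · unfold datum
    linarith [abs_nonneg x]
  · refine LipschitzWith.of_dist_le_mul fun x z => ?_
    rw [Real.dist_eq, Real.dist_eq, NNReal.coe_one, one_mul]
    have h1 : |truncatedDatum x - truncatedDatum z| ≤ |datum x - datum z| := by
      simpa [truncatedDatum] using abs_max_sub_max_le_max (datum x) (-1) (datum z) (-1)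
    have h2 : datum x - datum z = |z| - |x| := by unfold datum; ring
    rw [h2] at h1
    rw [abs_sub_comm x z]
    exact h1.trans (abs_abs_sub_abs_le_abs_sub z x)
  · exact max_eq_right (by unfold datum; linarith)

/-- Continuity in time is trivial for a stationary kernel, and the classical derivative is the weak
one by integration by parts. -/
theorem areAdmissibleCoefficients_of_contDiff {k : ℝ → ℝ} (hk : ContDiff ℝ ∞ k)
    (hc : HasCompactSupport k) :
    AreAdmissibleCoefficients 2 (fun x _ => k x) (fun _ => drift) := by
  have hki : Integrable k := hk.continuous.integrable_of_hasCompactSupport hc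
  have hdc : Continuous (deriv k) := hk.continuous_deriv (by simp)
  have hdi : Integrable (deriv k) := hdc.integrable_of_hasCompactSupport hc.deriv
  refine ⟨fun _ _ => hki, fun _ _ => by simpa using tendsto_const_nhds,
    ⟨fun x _ => deriv k x, ∫ x, |deriv k x|, ?_, ?_⟩,
    ?_, ⟨4, 0, fun x y t ht => ⟨?_, by simp⟩⟩⟩
  · exact (hdc.comp continuous_fst).aemeasurable
  · refine Eventually.of_forall fun t => ⟨⟨hki, hdi, fun ψ hψ hψc => ?_⟩, le_rfl⟩
    have hψd : Continuous (deriv ψ) := hψ.continuous_deriv (by simp)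
    refine integral_mul_deriv_eq_deriv_mul_of_integrable
      (fun x _ => (hk.differentiable (by simp) x).hasDerivAt)
      (fun x _ => (hψ.differentiable (by simp) x).hasDerivAt) ?_ ?_ ?_
    · exact (hk.continuous.mul hψd).integrable_of_hasCompactSupport hc.mul_right
    · exact (hdc.mul hψ.continuous).integrable_of_hasCompactSupport hc.deriv.mul_right
    · exact (hk.continuous.mul hψ.continuous).integrable_of_hasCompactSupport hc.mul_right
  · exact (continuous_drift.comp continuous_snd).continuousOn
  · unfold drift
    rw [abs_le]
    constructor <;> nlinarith [ht.1, ht.2]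

/-- A smooth compactly supported kernel which equals `1` on a given ball. -/
theorem exists_cutoff (R : ℝ) : ∃ k : ℝ → ℝ, ContDiff ℝ ∞ k ∧ HasCompactSupport k ∧
    (∀ x, 0 ≤ k x) ∧ (∀ x, |k x| ≤ 1) ∧ ∀ x, |x| ≤ R → k x = 1 := by
  have hR : 0 < max R 1 := lt_max_of_lt_right one_pos
  let f : ContDiffBump (0 : ℝ) := ⟨max R 1, max R 1 + 1, hR, by linarith⟩
  refine ⟨f, f.contDiff, f.hasCompactSupport, fun x => f.nonneg, fun x => ?_, fun x hx => ?_⟩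
  · rw [abs_of_nonneg f.nonneg]
    exact f.le_one
  · refine f.one_of_mem_closedBall ?_
    rw [mem_closedBall_zero_iff]
    exact hx.trans (le_max_left _ _)

end Dislocation

theorem mainTheorem4 :
    -- `x₁` solves its differential equation
    (x₁ 0 = 1 ∧ ∀ t ∈ Icc (0 : ℝ) 1, HasDerivAt x₁ (drift t + 2 * x₁ t) t) ∧
    -- `y_γ` exists and is unique
    (∀ γ, IsControl γ → ∃ y, SolvesODE γ y ∧ ∀ z, SolvesODE γ z → EqOn z y (Icc 1 2)) ∧
    -- properties of `y = y_γ` and of `U_γ = hopfLax datum y`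
    (∀ γ y, IsControl γ → SolvesODE γ y →
      (∀ y₀ y₁, SolvesODE (fun _ => 0) y₀ → SolvesODE (fun _ => 1) y₁ →
        ∀ t ∈ Icc (1 : ℝ) 2, 0 ≤ y₀ t ∧ y₀ t ≤ y t ∧ y t ≤ y₁ t) ∧
      MonotoneOn y (Icc 1 2) ∧
      (∀ t ∈ Ioc (1 : ℝ) 2, 0 < y t) ∧
      (∀ t ∈ Icc (0 : ℝ) 1, (∀ x, hopfLax datum y x t = datum (|x| - x₁ t + 1)) ∧
        {x | 0 < hopfLax datum y x t} = Ioo (-x₁ t) (x₁ t) ∧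
        {x | 0 ≤ hopfLax datum y x t} = Icc (-x₁ t) (x₁ t)) ∧
      (∀ t ∈ Icc (1 : ℝ) 2,
        (∀ x, hopfLax datum y x t
          = if |x| ≤ y t then 0 else hopfLax datum y (|x| - y t) 1) ∧
        {x | 0 < hopfLax datum y x t} = ∅ ∧
        {x | 0 ≤ hopfLax datum y x t} = Icc (-y t) (y t) ∧
        {x | hopfLax datum y x t = 0} = Icc (-y t) (y t)) ∧
      (∀ x, ∀ t ∈ Ico (0 : ℝ) 1,
        velocity (fun _ _ => 1) (fun _ => drift) (chi γ y) x t = drift t + 2 * x₁ t) ∧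
      (∀ x, ∀ t ∈ Icc (1 : ℝ) 2,
        velocity (fun _ _ => 1) (fun _ => drift) (chi γ y) x t = drift t + 2 * γ t * y t) ∧
      IsWeakSolutionWith 2 (fun _ _ => 1) (fun _ => drift) datum (hopfLax datum y) (chi γ y)) ∧
    -- `U_γ` determines `γ` almost everywhere, and conversely
    (∀ γ γ' y y', IsControl γ → IsControl γ' → SolvesODE γ y → SolvesODE γ' y' →
      ((∀ x, ∀ t ∈ Icc (0 : ℝ) 2, hopfLax datum y x t = hopfLax datum y' x t) ↔
        ∀ᵐ t ∂(volume.restrict (Icc (1 : ℝ) 2)), γ t = γ' t)) ∧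
    WeakSolutionsNotUnique 2 (fun _ _ => 1) (fun _ => drift) datum ∧
    -- the kernel modified at infinity and the datum truncated, so that all the assumptions of the
    -- general theory hold
    IsAdmissibleDatum truncatedDatum ∧
    (∀ R : ℝ, ∃ c₀ : ℝ → ℝ → ℝ,
      (∀ x t, 0 ≤ c₀ x t) ∧
      (∀ x t, |x| ≤ R → c₀ x t = 1) ∧
      AreAdmissibleCoefficients 2 c₀ (fun _ => drift) ∧
      (∀ γ y, IsControl γ → SolvesODE γ y →
        (∀ x, ∀ t ∈ Icc (0 : ℝ) 2,
          hopfLax truncatedDatum y x t = max (hopfLax datum y x t) (-1)) ∧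
        IsWeakSolutionWith 2 c₀ (fun _ => drift) truncatedDatum (hopfLax truncatedDatum y)
          (chi γ y)) ∧
      WeakSolutionsNotUnique 2 c₀ (fun _ => drift) truncatedDatum) := by
  refine ⟨⟨by simp [x₁], fun t _ => hasDerivAt_x₁ t⟩, fun γ hγ => ?_, fun γ y hγ hy => ?_,
    fun γ γ' y y' hγ hγ' hy hy' => hopfLax_eq_iff hγ hγ' hy hy', weakSolutionsNotUnique_datum,
    isAdmissibleDatum_truncatedDatum, fun R => ?_⟩
  · obtain ⟨y, hy⟩ := hγ.exists_solvesODE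
    exact ⟨y, hy, fun z hz => hz.eqOn_of_ae_eq hγ hγ hy (ae_of_all _ fun _ => rfl)⟩
  · have hnn := hy.nonneg hγ
    refine ⟨fun y₀ y₁ hy₀ hy₁ t ht => ⟨hy₀.nonneg (isControl_const (by simp)) t ht,
      hy.zero_le hγ hy₀ t ht, hy.mono hγ (isControl_const (by simp)) hy₁
        ((ae_restrict_mem measurableSet_Icc).mono fun t ht => (hγ.2 t ht).2) t ht⟩,
      hy.monotoneOn hγ, hy.pos hγ, fun t ht => ?_, fun t ht => ?_, fun x t ht => ?_,
      fun x t ht => ?_, hy.isWeakSolutionWith_hopfLax hγ⟩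
    · have e : ∀ x, hopfLax datum y x t = profile y x t := fun x =>
        hopfLax_datum hnn x ⟨ht.1, ht.2.trans one_le_two⟩
      simp only [e]
      refine ⟨fun x => ?_, setOf_profile_pos_of_le ht.2, setOf_profile_nonneg_of_le ht.2⟩
      have h1 := x₁_le_one (t := t) ⟨ht.1, ht.2.trans one_le_two⟩
      rw [profile_of_le ht.2, datum,
        abs_of_nonneg (show 0 ≤ |x| - x₁ t + 1 by linarith [abs_nonneg x])]
      ring
    · have e : ∀ x, hopfLax datum y x t = profile y x t := fun x =>
        hopfLax_datum hnn x ⟨zero_le_one.trans ht.1, ht.2⟩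
      have e1 : ∀ x, hopfLax datum y x 1 = -|x| := fun x => by
        rw [hopfLax_datum hnn x ⟨zero_le_one, one_le_two⟩, profile_of_le le_rfl]
        simp [x₁]
      simp only [e, e1]
      refine ⟨fun x => ?_, ?_, hy.setOf_profile_nonneg ht.1, hy.setOf_profile_eq_zero ht.1⟩
      · rw [hy.profile_of_ge ht.1]
        split_ifs with h
        · exact min_eq_left (by linarith)
        · rw [min_eq_right (by linarith), abs_of_nonneg (show 0 ≤ |x| - y t by linarith)]
          ring
      · exact eq_empty_of_forall_notMem fun x hx => not_lt.2 (hy.profile_nonpos ht.1 x) hx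
    · refine (hy.velocity_eq_speed (k := fun _ => 1) hγ ⟨ht.1, ht.2.le.trans one_le_two⟩
        fun _ _ => rfl).trans (if_pos ht.2)
    · exact (hy.velocity_eq_speed (k := fun _ => 1) hγ ⟨zero_le_one.trans ht.1, ht.2⟩
        fun _ _ => rfl).trans (speed_of_ge ht.1)
  -- The `3` ensures that the kernel is `1` on all differences seen by the truncated solution, even
  -- for small `R`.
  · obtain ⟨k, hk, hkc, hk0, hk1, hkR⟩ := exists_cutoff (max R 3)
    obtain ⟨L, hL⟩ := ContDiff.lipschitzWith_of_hasCompactSupport hkc hk (by simp)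
    have hk3 : ∀ x, |x| ≤ 3 → k x = 1 := fun x hx => hkR x (hx.trans (le_max_right _ _))
    refine ⟨fun x _ => k x, fun x _ => hk0 x, fun x _ hx => hkR x (hx.trans (le_max_left _ _)),
      areAdmissibleCoefficients_of_contDiff hk hkc, fun γ y hγ hy => ⟨fun x t ht => ?_,
        hy.isWeakSolutionWith_truncated hγ hk1 hL hk3⟩,
      weakSolutionsNotUnique_truncatedDatum hk1 hL hk3⟩
    rw [hopfLax_datum (hy.nonneg hγ) x ht, hopfLax_truncatedDatum (hy.nonneg hγ) x ht]
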